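/- Let $M$ be a smooth compact Hausdorff manifold, possibly with boundary or corners, that is not a single point; let $\mu_0$ be a smooth positive density on $M$ with $\int_M\mu_0=1$, and let $S=\{\varphi\in L^2(M,\mu_0):\int_M\varphi^2\mu_0=1\}$ be the unit sphere of the real Hilbert space $L^2(M,\mu_0)$. Let $C_1,C_2:(0,\infty)\to\mathbb R$ be smooth with $C_1(x)>0$ and $C_2(x)>-\tfrac1x C_1(x)$ for all $x>0$, so that $G_\mu(\alpha,\beta)=C_1(\mu(M))\int_M\frac{\alpha}{\mu}\frac{\beta}{\mu}\mu+C_2(\mu(M))\int_M\alpha\int_M\beta$ is a Riemannian metric on the smooth positive densities of $M$. Put $$W(r)=\int_1^r\sqrt{4\left(C_1(\rho^2)+C_2(\rho^2)\rho^2\right)}\,d\rho\quad(r>0),\qquad W_-=\lim_{r\to0+}W(r),\quad W_+=\lim_{r\to\infty}W(r),$$ and assume $(W_-,W_+)=(-\infty,+\infty)$. Let $r(s)$ denote the inverse function of $W:(0,\infty)\to\mathbb R$, let $a(s)=4C_1(r(s)^2)\,r(s)^2$, and equip $\mathbb R\times S$ with the Riemannian metric $\bar G=ds^2+a(s)\langle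 d\varphi,d\varphi\rangle$, the expression of $G$ under $\mu = r(s)^2\varphi^2\mu_0$. A minimal geodesic from $(s_0,\varphi_0)$ to $(s_1,\varphi_1)$ is a smooth curve $c=(s,\varphi):[0,1]\to\mathbb R\times S$ with these end points that solves the geodesic equation of $\bar G$, $$\nabla^S_{\partial_t}\varphi_t=-\partial_t(\log a(s))\,\varphi_t,\qquad s_{tt}=\tfrac12a'(s)\|\varphi_t\|^2,$$ where $\nabla^S_{\partial_t}\varphi_t=\varphi_{tt}-\langle\varphi,\varphi_{tt}\rangle\varphi$, and whose length $\int_0^1\sqrt{s_t^2+a(s)\|\varphi_t\|^2}\,dt$ is at most that of every $C^1$ curve in $\mathbb R\times S$ with the same end points. Then any two points $(s_0,\varphi_0)$ and $(s_1,\varphi_1)$ of $\mathbb R\times S$ can be joined by a minimal geodesic. If moreover $\varphi_0$ and $\varphi_1$ lie in $S\cap C^\infty(M)$ (that is, are represented by smooth functions on $M$), then they can be joined by a minimal geodesic that lies in $\mathbb R\times(S\cap C^\infty(M))$, and if in addition $\varphi_1\neq-\varphi_0$, then every minimal geodesic between the two points lies in $\mathbb R\times(S\cap C^\infty(M))$.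 -/

import Mathlib

open Set Filter Topology MeasureTheory
open scoped ContDiff Manifold

noncomputable section

namespace DensityMetric

/-! ### The radial functions attached to the coefficients `C₁`, `C₂` of the metric
`G_μ(α,β) = C₁(μ(M)) ∫ (α/μ)(β/μ) μ + C₂(μ(M)) ∫ α ∫ β`. -/

/-- `g₁(r) = 4 C₁(r²) r²`. -/
def gOne (C₁ : ℝ → ℝ) (r : ℝ) : ℝ := 4 * C₁ (r ^ 2) * r ^ 2

/-- `g₂(r) = 4 (C₁(r²) + C₂(r²) r²)`. -/
def gTwo (C₁ C₂ : ℝ → ℝ) (r : ℝ) : ℝ := 4 * (C₁ (r ^ 2) + C₂ (r ^ 2) * r ^ 2)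

/-- `W(r) = ∫₁^r √(g₂(ρ)) dρ`, for `r > 0`. -/
def radialW (C₁ C₂ : ℝ → ℝ) (r : ℝ) : ℝ := ∫ ρ in (1 : ℝ)..r, √(gTwo C₁ C₂ ρ)

/-- `r(s)`: the inverse of `W` on `(0, ∞)`. -/
def radius (C₁ C₂ : ℝ → ℝ) (s : ℝ) : ℝ := Function.invFunOn (radialW C₁ C₂) (Ioi 0) s

/-- `a(s) = 4 C₁(r(s)²) r(s)²`, the warping function of `ds² + a(s) ⟨dφ, dφ⟩`. -/
def warp (C₁ C₂ : ℝ → ℝ) (s : ℝ) : ℝ := gOne C₁ (radius C₁ C₂ s)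

/-! ### The manifold `ℝ × S` with the metric `ds² + a(s) ⟨dφ, dφ⟩`

Here `S` is the unit sphere of a real Hilbert space `X`.  A curve in `ℝ × S`, parametrized by
`[0,1]`, is a map `c : ℝ → ℝ × X` whose second component has norm one on `[0,1]`; its values
outside `[0,1]` play no role. -/

section Warped

variable {X : Type*} [NormedAddCommGroup X] [InnerProductSpace ℝ X]

/-- The velocity `c'(t)`, one-sided at the ends of `[0,1]`. -/
def velocity (c : ℝ → ℝ × X) (t : ℝ) : ℝ × X := derivWithin c (Icc 0 1) t

/-- The second derivative `c''(t)` in `ℝ × X`, one-sided at the ends of `[0,1]`. -/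
def acceleration (c : ℝ → ℝ × X) (t : ℝ) : ℝ × X := derivWithin (velocity c) (Icc 0 1) t

/-- The length `∫₀¹ √(s_t² + a(s) ‖φ_t‖²) dt` of `c = (s, φ)`. -/
def curveLength (a : ℝ → ℝ) (c : ℝ → ℝ × X) : ℝ :=
  ∫ t in (0 : ℝ)..1, √((velocity c t).1 ^ 2 + a (c t).1 * ‖(velocity c t).2‖ ^ 2)

/-- `c : [0,1] → ℝ × S` is a curve of class `C^k` from `p` to `q`. -/
structure IsCurve (k : ℕ∞) (p q : ℝ × Metric.sphere (0 : X) 1) (c : ℝ → ℝ × X) : Prop where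
  contDiffOn : ContDiffOn ℝ k c (Icc 0 1)
  mem_sphere : ∀ t ∈ Icc (0 : ℝ) 1, (c t).2 ∈ Metric.sphere (0 : X) 1
  source : c 0 = (p.1, (p.2 : X))
  target : c 1 = (q.1, (q.2 : X))

/-- The geodesic equation of `ds² + a(s) ⟨dφ, dφ⟩` on `ℝ × S`:
`∇^S_{∂t} φ_t = - ∂_t (log a(s)) φ_t` and `s_tt = ½ a'(s) ‖φ_t‖²`.
The covariant derivative `∇^S_{∂t} φ_t` of the sphere is the tangential part
`φ_tt - ⟨φ, φ_tt⟩ φ` of `φ_tt`, and `∂_t (log a(s)) = a'(s) s_t / a(s)`. -/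
structure SatisfiesGeodesicEquation (a : ℝ → ℝ) (c : ℝ → ℝ × X) : Prop where
  spherical : ∀ t ∈ Icc (0 : ℝ) 1,
    (acceleration c t).2 - (inner ℝ (c t).2 (acceleration c t).2) • (c t).2 =
      -(deriv a (c t).1 * (velocity c t).1 / a (c t).1) • (velocity c t).2
  radial : ∀ t ∈ Icc (0 : ℝ) 1,
    (acceleration c t).1 = (1 / 2) * deriv a (c t).1 * ‖(velocity c t).2‖ ^ 2

/-- `c` is a minimal geodesic from `p` to `q` in `ℝ × S`: a smooth solution of the geodesic
equation that is no longer than any `C¹` curve in `ℝ × S` from `p` to `q`. -/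
structure IsMinimalGeodesic (a : ℝ → ℝ) (p q : ℝ × Metric.sphere (0 : X) 1)
    (c : ℝ → ℝ × X) : Prop where
  isCurve : IsCurve ⊤ p q c
  geodesic : SatisfiesGeodesicEquation a c
  minimal : ∀ d : ℝ → ℝ × X, IsCurve 1 p q d → curveLength a c ≤ curveLength a d

end Warped

/-! ### Smooth densities and smooth functions on a manifold with corners -/

section Density

variable {m : ℕ} {H : Type*} [TopologicalSpace H]
  {M : Type*} [TopologicalSpace M] [ChartedSpace H M] [MeasurableSpace M]

/-- `μ` is (the measure given by) a smooth positive density on `M`: in every chart it is a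
smooth positive function times Lebesgue measure. -/
def IsSmoothPositiveDensity (I : ModelWithCorners ℝ (EuclideanSpace ℝ (Fin m)) H)
    (μ : Measure M) : Prop :=
  ∀ e ∈ atlas H M, ∃ ρ : EuclideanSpace ℝ (Fin m) → ℝ,
    ContDiffOn ℝ ∞ ρ (e.extend I).target ∧
    (∀ y ∈ (e.extend I).target, 0 < ρ y) ∧
    ∀ A : Set M, MeasurableSet A → A ⊆ e.source →
      μ A = ∫⁻ y in e.extend I '' A, ENNReal.ofReal (ρ y)

/-- The class `φ ∈ L²(M, μ)` is represented by a smooth function on `M`. -/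
def IsSmoothClass (I : ModelWithCorners ℝ (EuclideanSpace ℝ (Fin m)) H) {μ : Measure M}
    (φ : Lp ℝ 2 μ) : Prop :=
  ∃ f : M → ℝ, ContMDiff I 𝓘(ℝ, ℝ) ∞ f ∧ φ =ᵐ[μ] f

end Density

end DensityMetric

end

/-! The sphere is infinite-dimensional, so local compactness is not available; everything is reduced
to a one-dimensional variational problem. Since `W' > 0` and `W` maps `(0,∞)` onto `ℝ`, the function
`a` is smooth and positive on all of `ℝ`.

A curve on the sphere is at least as long as the angle `θ` between its end points
(`arccos_inner_le_integral_norm`). For a fixed radial part `s`, an angular speed `w` with `∫ w ≥ θ`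
has `∫ a(s) w² ≥ θ² / ∫ 1/a(s)`, with equality for `w = κ / a(s)`, `κ = θ / ∫ 1/a(s)`
(`reducedEnergy_le`). What is left is to minimize `‖u‖² + θ² / ∫ 1/a(s₀ + ∫₀ᵗ u)` over `u = s_t` in
`L²(0,1)` with prescribed integral. The norm is weakly lower semicontinuous and the second term is
weakly continuous, so the direct method gives a minimizer (`exists_reducedEnergy_minimizer`). Its
Euler-Lagrange equation is the radial geodesic equation and makes it smooth
(`exists_optimal_profile`). Running along a great circle with angular speed `κ / a` gives the
geodesic. Nearly constant speed reparametrization of competitors turns minimal energy into minimal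
length (`exists_isMinimalGeodesic`).

The great circle may be taken in any linear subspace that contains both end points and is not a
line. The whole of `L²` gives existence; the smooth classes give a smooth geodesic. Conversely, the
spherical part of a geodesic solves a linear second order equation, so it stays in the plane of its
initial data, which is the plane of the end points when these are neither equal nor antipodal
(`SatisfiesGeodesicEquation.mem_submodule`). For equal spherical parts, minimality forces a constant
spherical part (`IsMinimalGeodesic.snd_eq`). Antipodal points are exceptional because every great
circle through them carries a minimal geodesic. -/

namespace DensityMetric

/-! ### The radial coordinate and the warping function. -/

section Radial

variable {C₁ C₂ : ℝ → ℝ}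

theorem gTwo_pos (h : ∀ x : ℝ, 0 < x → -(1 / x) * C₁ x < C₂ x) {r : ℝ} (hr : 0 < r) :
    0 < gTwo C₁ C₂ r := by
  have hr2 : 0 < r ^ 2 := by positivity
  have := mul_lt_mul_of_pos_right (h (r ^ 2) hr2) hr2
  have h2 : -(1 / r ^ 2) * C₁ (r ^ 2) * r ^ 2 = - C₁ (r ^ 2) := by field_simp
  unfold gTwo
  linarith

theorem contDiffOn_sqrt_gTwo (hC₁ : ContDiffOn ℝ ∞ C₁ (Ioi 0)) (hC₂ : ContDiffOn ℝ ∞ C₂ (Ioi 0))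
    (h : ∀ x : ℝ, 0 < x → -(1 / x) * C₁ x < C₂ x) :
    ContDiffOn ℝ ∞ (fun r => √(gTwo C₁ C₂ r)) (Ioi 0) := by
  have hsq : ContDiffOn ℝ ∞ (fun r : ℝ => r ^ 2) (Ioi 0) := by fun_prop
  have hm : MapsTo (fun r : ℝ => r ^ 2) (Ioi 0) (Ioi 0) := fun r (hr : 0 < r) => by
    simp only [mem_Ioi]; positivity
  refine ContDiffOn.sqrt ?_ fun r hr => (gTwo_pos h hr).ne'
  exact contDiffOn_const.mul ((hC₁.comp hsq hm).add ((hC₂.comp hsq hm).mul hsq))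

theorem hasDerivAt_radialW (hC₁ : ContDiffOn ℝ ∞ C₁ (Ioi 0)) (hC₂ : ContDiffOn ℝ ∞ C₂ (Ioi 0))
    (h : ∀ x : ℝ, 0 < x → -(1 / x) * C₁ x < C₂ x) {r : ℝ} (hr : 0 < r) :
    HasDerivAt (radialW C₁ C₂) (√(gTwo C₁ C₂ r)) r := by
  have hc := (contDiffOn_sqrt_gTwo hC₁ hC₂ h).continuousOn
  refine intervalIntegral.integral_hasDerivAt_right ?_ ?_ ?_
  · refine (hc.mono fun x hx => ?_).intervalIntegrable
    exact lt_of_lt_of_le (lt_min one_pos hr) hx.1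
  · exact hc.stronglyMeasurableAtFilter isOpen_Ioi r hr
  · exact hc.continuousAt (Ioi_mem_nhds hr)

theorem contDiffOn_radialW (hC₁ : ContDiffOn ℝ ∞ C₁ (Ioi 0)) (hC₂ : ContDiffOn ℝ ∞ C₂ (Ioi 0))
    (h : ∀ x : ℝ, 0 < x → -(1 / x) * C₁ x < C₂ x) :
    ContDiffOn ℝ ∞ (radialW C₁ C₂) (Ioi 0) := by
  rw [contDiffOn_infty_iff_deriv_of_isOpen isOpen_Ioi]
  refine ⟨fun r hr => (hasDerivAt_radialW hC₁ hC₂ h hr).differentiableAt.differentiableWithinAt, ?_⟩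
  exact (contDiffOn_sqrt_gTwo hC₁ hC₂ h).congr fun r hr => (hasDerivAt_radialW hC₁ hC₂ h hr).deriv

theorem strictMonoOn_radialW (hC₁ : ContDiffOn ℝ ∞ C₁ (Ioi 0)) (hC₂ : ContDiffOn ℝ ∞ C₂ (Ioi 0))
    (h : ∀ x : ℝ, 0 < x → -(1 / x) * C₁ x < C₂ x) :
    StrictMonoOn (radialW C₁ C₂) (Ioi 0) := by
  refine strictMonoOn_of_deriv_pos (convex_Ioi 0) (contDiffOn_radialW hC₁ hC₂ h).continuousOn ?_
  intro r hr
  rw [interior_Ioi] at hr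
  rw [(hasDerivAt_radialW hC₁ hC₂ h hr).deriv]
  exact Real.sqrt_pos.2 (gTwo_pos h hr)

/-- The two infinite limits of `W` make the coordinate `s` range over all of `ℝ`, so no radial curve
reaches an end in finite length. -/
theorem surjOn_radialW (hC₁ : ContDiffOn ℝ ∞ C₁ (Ioi 0)) (hC₂ : ContDiffOn ℝ ∞ C₂ (Ioi 0))
    (h : ∀ x : ℝ, 0 < x → -(1 / x) * C₁ x < C₂ x)
    (hm : Tendsto (radialW C₁ C₂) (𝓝[>] 0) atBot) (hp : Tendsto (radialW C₁ C₂) atTop atTop) :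
    SurjOn (radialW C₁ C₂) (Ioi 0) univ := by
  intro s _
  obtain ⟨x, hx, hx0⟩ := ((hm.eventually_le_atBot s).and self_mem_nhdsWithin).exists
  obtain ⟨y, hy, hy0⟩ := ((hp.eventually_ge_atTop s).and (eventually_gt_atTop 0)).exists
  exact isPreconnected_Ioi.intermediate_value hx0 hy0
    (contDiffOn_radialW hC₁ hC₂ h).continuousOn ⟨hx, hy⟩

theorem radius_pos (hs : SurjOn (radialW C₁ C₂) (Ioi 0) univ) (s : ℝ) : 0 < radius C₁ C₂ s :=
  Function.invFunOn_mem (hs (mem_univ s))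

theorem radialW_radius (hs : SurjOn (radialW C₁ C₂) (Ioi 0) univ) (s : ℝ) :
    radialW C₁ C₂ (radius C₁ C₂ s) = s :=
  Function.invFunOn_eq (hs (mem_univ s))

/-- Near `s` the inverse function theorem supplies a smooth local right inverse of `W` with positive
values. `radius` is another one, and injectivity of `W` on `(0,∞)` makes them agree. -/
theorem contDiff_radius (hC₁ : ContDiffOn ℝ ∞ C₁ (Ioi 0)) (hC₂ : ContDiffOn ℝ ∞ C₂ (Ioi 0))
    (h : ∀ x : ℝ, 0 < x → -(1 / x) * C₁ x < C₂ x)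
    (hs : SurjOn (radialW C₁ C₂) (Ioi 0) univ) :
    ContDiff ℝ ∞ (radius C₁ C₂) := by
  rw [contDiff_iff_contDiffAt]
  intro s
  have hr := radius_pos hs s
  have hW := (contDiffOn_radialW hC₁ hC₂ h).contDiffAt (Ioi_mem_nhds hr)
  have hd := hasDerivAt_radialW hC₁ hC₂ h hr
  have hne : √(gTwo C₁ C₂ (radius C₁ C₂ s)) ≠ 0 := (Real.sqrt_pos.2 (gTwo_pos h hr)).ne'
  have hf : HasFDerivAt (radialW C₁ C₂) ((ContinuousLinearEquiv.unitsEquivAut ℝ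
      (Units.mk0 _ hne) : ℝ ≃L[ℝ] ℝ) : ℝ →L[ℝ] ℝ) (radius C₁ C₂ s) :=
    hd.hasFDerivAt_equiv hne
  have hinv := hW.to_localInverse hf (by simp)
  have hstrict := hW.hasStrictFDerivAt' hf (by simp)
  rw [radialW_radius hs] at hinv
  refine hinv.congr_of_eventuallyEq ?_
  have h1 := hstrict.eventually_right_inverse
  have h2 := hstrict.localInverse_tendsto
  have h3 := hstrict.localInverse_apply_image
  rw [radialW_radius hs] at h1 h2
  filter_upwards [h1, h2.eventually (Ioi_mem_nhds hr)] with x hx hx0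
  exact (strictMonoOn_radialW hC₁ hC₂ h).injOn (radius_pos hs x) hx0
    ((radialW_radius hs x).trans hx.symm)

theorem contDiff_warp (hC₁ : ContDiffOn ℝ ∞ C₁ (Ioi 0)) (hC₂ : ContDiffOn ℝ ∞ C₂ (Ioi 0))
    (h : ∀ x : ℝ, 0 < x → -(1 / x) * C₁ x < C₂ x)
    (hs : SurjOn (radialW C₁ C₂) (Ioi 0) univ) :
    ContDiff ℝ ∞ (warp C₁ C₂) := by
  have hr := contDiff_radius hC₁ hC₂ h hs
  have h2 : ContDiff ℝ ∞ fun s => radius C₁ C₂ s ^ 2 := hr.pow 2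
  have h1 : ContDiff ℝ ∞ fun s => C₁ (radius C₁ C₂ s ^ 2) :=
    hC₁.comp_contDiff h2 fun s => pow_pos (radius_pos hs s) 2
  exact (contDiff_const.mul h1).mul h2

theorem warp_pos (hpos₁ : ∀ x : ℝ, 0 < x → 0 < C₁ x)
    (hs : SurjOn (radialW C₁ C₂) (Ioi 0) univ) (s : ℝ) : 0 < warp C₁ C₂ s := by
  have h2 := pow_pos (radius_pos hs s) 2
  have := hpos₁ _ h2
  unfold warp gOne
  positivity

end Radial

/-! ### Curves on the sphere and rigidity of geodesics. -/

section Sphere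

variable {X : Type*} [NormedAddCommGroup X] [InnerProductSpace ℝ X]

theorem inner_hasDerivAt_eq_zero {φ : ℝ → X} {v : X} {t : ℝ} (hd : HasDerivAt φ v t)
    (hn : ∀ᶠ x in 𝓝 t, ‖φ x‖ = 1) : inner ℝ (φ t) v = 0 := by
  have h1 := hd.inner ℝ hd
  have h2 : (fun x => inner ℝ (φ x) (φ x)) =ᶠ[𝓝 t] fun _ => (1 : ℝ) := by
    filter_upwards [hn] with x hx
    rw [real_inner_self_eq_norm_sq, hx, one_pow]
  have h3 := h1.unique ((hasDerivAt_const t (1 : ℝ)).congr_of_eventuallyEq h2)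
  rw [real_inner_comm v] at h3
  linarith [real_inner_comm (φ t) v]

/-- As `v ⟂ x`, only the component of `e` orthogonal to `x` contributes, and its norm is `√(1 -
⟨e,x⟩²)`. -/
theorem abs_inner_le_of_unit {e x v : X} (he : ‖e‖ = 1) (hx : ‖x‖ = 1) (hv : inner ℝ x v = 0) :
    |inner ℝ e v| ≤ √(1 - inner ℝ e x ^ 2) * ‖v‖ := by
  have h1 : inner ℝ e v = inner ℝ (e - inner ℝ e x • x) v := by
    rw [inner_sub_left, real_inner_smul_left, hv, mul_zero, sub_zero]
  have h2 : ‖e - inner ℝ e x • x‖ ^ 2 = 1 - inner ℝ e x ^ 2 := by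
    rw [norm_sub_sq_real, real_inner_smul_right, norm_smul, he, hx, Real.norm_eq_abs, mul_one,
      sq_abs]
    ring
  rw [h1, ← h2, Real.sqrt_sq (norm_nonneg _)]
  exact abs_real_inner_le_norm _ _

/-- A curve on the unit sphere is at least as long as the angle between its end points. -/
theorem arccos_inner_le_integral_norm {φ φ' : ℝ → X} (hc : ContinuousOn φ (Icc 0 1))
    (hd : ∀ t ∈ Ioo (0 : ℝ) 1, HasDerivAt φ (φ' t) t) (hc' : ContinuousOn φ' (Icc 0 1))
    (hn : ∀ t ∈ Icc (0 : ℝ) 1, ‖φ t‖ = 1) :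
    Real.arccos (inner ℝ (φ 0) (φ 1)) ≤ ∫ t in (0 : ℝ)..1, ‖φ' t‖ := by
  have h0 : ‖φ 0‖ = 1 := hn 0 (by simp)
  -- `arccos` is not differentiable at `±1`, which the curve may hit; the factor `κ < 1` keeps its
  -- argument inside `(-1,1)` and is sent to `1` at the end.
  have key : ∀ κ ∈ Ioo (0 : ℝ) 1, Real.arccos (κ * inner ℝ (φ 0) (φ 1)) - Real.arccos κ ≤
      ∫ t in (0 : ℝ)..1, ‖φ' t‖ := by
    intro κ hκ
    have hfc : ContinuousOn (fun t => κ * inner ℝ (φ 0) (φ t)) (Icc 0 1) :=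
      continuousOn_const.mul (continuousOn_const.inner hc)
    have hf1 : ∀ t ∈ Icc (0 : ℝ) 1, |inner ℝ (φ 0) (φ t)| ≤ 1 := fun t ht => by
      simpa [h0, hn t ht] using abs_real_inner_le_norm (φ 0) (φ t)
    have := intervalIntegral.sub_le_integral_of_hasDeriv_right_of_le
      (g := fun t => Real.arccos (κ * inner ℝ (φ 0) (φ t)))
      (g' := fun t => -(1 / √(1 - (κ * inner ℝ (φ 0) (φ t)) ^ 2)) * (κ * inner ℝ (φ 0) (φ' t)))
      (φ := fun t => ‖φ' t‖) zero_le_one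
      (Real.continuous_arccos.comp_continuousOn hfc) ?_
      (hc'.norm.integrableOn_Icc) ?_
    · simpa [h0] using this
    · intro t ht
      have hlt : |κ * inner ℝ (φ 0) (φ t)| < 1 := by
        rw [abs_mul, abs_of_pos hκ.1]
        nlinarith [hf1 t (Ioo_subset_Icc_self ht), hκ.1, hκ.2, abs_nonneg (inner ℝ (φ 0) (φ t))]
      rw [abs_lt] at hlt
      have hfd : HasDerivAt (fun t => κ * inner ℝ (φ 0) (φ t)) (κ * inner ℝ (φ 0) (φ' t)) t := by
        have := ((hasDerivAt_const t (φ 0)).inner ℝ (hd t ht)).const_mul κ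
        simpa using this
      exact ((Real.hasDerivAt_arccos hlt.1.ne' hlt.2.ne).comp t hfd).hasDerivWithinAt
    · intro t ht
      have ht' := Ioo_subset_Icc_self ht
      have hv : inner ℝ (φ t) (φ' t) = 0 := inner_hasDerivAt_eq_zero (hd t ht) <| by
        filter_upwards [Ioo_mem_nhds ht.1 ht.2] with x hx using hn x (Ioo_subset_Icc_self hx)
      have hb := abs_inner_le_of_unit h0 (hn t ht') hv
      set f := inner ℝ (φ 0) (φ t)
      set y := inner ℝ (φ 0) (φ' t)
      have hf := hf1 t ht'
      have hf2 : f ^ 2 ≤ 1 := (sq_le_one_iff_abs_le_one f).2 hf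
      have hκ2 : κ ^ 2 < 1 := by nlinarith [hκ.1, hκ.2]
      have hpos : 0 < 1 - (κ * f) ^ 2 := by nlinarith [sq_nonneg f, sq_nonneg κ]
      have hs : κ * √(1 - f ^ 2) ≤ √(1 - (κ * f) ^ 2) := by
        refine Real.le_sqrt_of_sq_le ?_
        rw [mul_pow, Real.sq_sqrt (by linarith)]
        nlinarith
      have hsp := Real.sqrt_pos.2 hpos
      calc -(1 / √(1 - (κ * f) ^ 2)) * (κ * y) = (κ * (-y)) / √(1 - (κ * f) ^ 2) := by
            field_simp
        _ ≤ (√(1 - (κ * f) ^ 2) * ‖φ' t‖) / √(1 - (κ * f) ^ 2) := by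
            refine div_le_div_of_nonneg_right ?_ hsp.le
            calc κ * (-y) ≤ κ * (√(1 - f ^ 2) * ‖φ' t‖) :=
                  mul_le_mul_of_nonneg_left ((neg_le_abs y).trans hb) hκ.1.le
              _ = (κ * √(1 - f ^ 2)) * ‖φ' t‖ := by ring
              _ ≤ _ := mul_le_mul_of_nonneg_right hs (norm_nonneg _)
        _ = ‖φ' t‖ := mul_div_cancel_left₀ _ hsp.ne'
  have hlim : Tendsto (fun κ : ℝ => Real.arccos (κ * inner ℝ (φ 0) (φ 1)) - Real.arccos κ)
      (𝓝[<] 1) (𝓝 (Real.arccos (inner ℝ (φ 0) (φ 1)))) := by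
    have : Continuous fun κ : ℝ => Real.arccos (κ * inner ℝ (φ 0) (φ 1)) - Real.arccos κ :=
      (Real.continuous_arccos.comp (continuous_id.mul continuous_const)).sub
        Real.continuous_arccos
    simpa using (this.tendsto 1).mono_left nhdsWithin_le_nhds
  refine le_of_tendsto hlim ?_
  filter_upwards [Ioo_mem_nhdsLT (zero_lt_one' ℝ)] with κ hκ using key κ hκ

/-- A solution of a scalar second order linear equation with zero initial data vanishes. -/
theorem eq_zero_of_second_order_linear {z z' α β : ℝ → ℝ}
    (hz : ∀ t ∈ Icc (0 : ℝ) 1, HasDerivWithinAt z (z' t) (Icc 0 1) t)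
    (hz' : ∀ t ∈ Icc (0 : ℝ) 1, HasDerivWithinAt z' (α t * z t + β t * z' t) (Icc 0 1) t)
    (hα : ContinuousOn α (Icc 0 1)) (hβ : ContinuousOn β (Icc 0 1))
    (h0 : z 0 = 0) (h0' : z' 0 = 0) : ∀ t ∈ Icc (0 : ℝ) 1, z t = 0 := by
  obtain ⟨A, hA⟩ := isCompact_Icc.exists_bound_of_continuousOn hα
  obtain ⟨B, hB⟩ := isCompact_Icc.exists_bound_of_continuousOn hβ
  have hA0 : 0 ≤ A := (norm_nonneg _).trans (hA 0 (by simp))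
  have hB0 : 0 ≤ B := (norm_nonneg _).trans (hB 0 (by simp))
  have hlip : ∀ t ∈ Ico (0 : ℝ) 1, LipschitzOnWith (Real.toNNReal (1 + A + B))
      (fun w : ℝ × ℝ => (w.2, α t * w.1 + β t * w.2)) univ := by
    intro t ht
    refine LipschitzWith.lipschitzOnWith (LipschitzWith.of_dist_le_mul fun w₁ w₂ => ?_)
    rw [Real.coe_toNNReal _ (by positivity), dist_eq_norm, dist_eq_norm]
    have ha := hA t (Ico_subset_Icc_self ht)
    have hb := hB t (Ico_subset_Icc_self ht)
    have h1 : ‖w₁.1 - w₂.1‖ ≤ ‖w₁ - w₂‖ := norm_fst_le (w₁ - w₂)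
    have h2 : ‖w₁.2 - w₂.2‖ ≤ ‖w₁ - w₂‖ := norm_snd_le (w₁ - w₂)
    have hw := norm_nonneg (w₁ - w₂)
    refine (Prod.norm_def _).trans_le (max_le ?_ ?_)
    · refine h2.trans ?_
      nlinarith
    · have : α t * w₁.1 + β t * w₁.2 - (α t * w₂.1 + β t * w₂.2) =
          α t * (w₁.1 - w₂.1) + β t * (w₁.2 - w₂.2) := by ring
      simp only [Prod.snd_sub]
      rw [this]
      calc _ ≤ ‖α t‖ * ‖w₁.1 - w₂.1‖ + ‖β t‖ * ‖w₁.2 - w₂.2‖ := by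
            rw [← norm_mul, ← norm_mul]; exact norm_add_le _ _
        _ ≤ A * ‖w₁ - w₂‖ + B * ‖w₁ - w₂‖ := by gcongr
        _ ≤ _ := by nlinarith
  have hright : ∀ {f : ℝ → ℝ} {f' t : ℝ}, t ∈ Ico (0 : ℝ) 1 →
      HasDerivWithinAt f f' (Icc 0 1) t → HasDerivWithinAt f f' (Ici t) t := fun ht h =>
    h.mono_of_mem_nhdsWithin (mem_of_superset (Icc_mem_nhdsGE ht.2) (Icc_subset_Icc_left ht.1))
  have := ODE_solution_unique_of_mem_Icc_right
    (v := fun t (w : ℝ × ℝ) => (w.2, α t * w.1 + β t * w.2)) (s := fun _ => univ)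
    (f := fun t => (z t, z' t)) (g := fun _ => (0, 0)) hlip
    (fun t ht => (hz t ht).continuousWithinAt.prodMk (hz' t ht).continuousWithinAt)
    (fun t ht => (hright ht (hz t (Ico_subset_Icc_self ht))).prodMk
      (hright ht (hz' t (Ico_subset_Icc_self ht))))
    (fun _ _ => mem_univ _) continuousOn_const
    (fun t _ => (hasDerivWithinAt_const t (Ici t) ((0 : ℝ), (0 : ℝ))).congr_deriv
      (by simp only [mul_zero, add_zero]; rfl))
    (fun _ _ => mem_univ _) (by simp [h0, h0'])
  exact fun t ht => congrArg Prod.fst (this ht)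

theorem hasDerivWithinAt_velocity {k : ℕ∞} (hk : 1 ≤ k) {c : ℝ → ℝ × X}
    (hc : ContDiffOn ℝ k c (Icc 0 1)) {t : ℝ} (ht : t ∈ Icc (0 : ℝ) 1) :
    HasDerivWithinAt c (velocity c t) (Icc 0 1) t :=
  ((hc.differentiableOn (by exact_mod_cast (zero_lt_one.trans_le hk).ne')) t ht).hasDerivWithinAt

theorem continuousOn_velocity {k : ℕ∞} (hk : 1 ≤ k) {c : ℝ → ℝ × X}
    (hc : ContDiffOn ℝ k c (Icc 0 1)) : ContinuousOn (velocity c) (Icc 0 1) :=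
  hc.continuousOn_derivWithin (uniqueDiffOn_Icc zero_lt_one) (by exact_mod_cast hk)

theorem contDiffOn_velocity {c : ℝ → ℝ × X} (hc : ContDiffOn ℝ ∞ c (Icc 0 1)) :
    ContDiffOn ℝ ∞ (velocity c) (Icc 0 1) :=
  ((contDiffOn_infty_iff_derivWithin (uniqueDiffOn_Icc zero_lt_one)).1 hc).2

theorem hasDerivWithinAt_fst {c : ℝ → ℝ × X} {v : ℝ × X} {S : Set ℝ} {t : ℝ}
    (h : HasDerivWithinAt c v S t) : HasDerivWithinAt (fun t => (c t).1) v.1 S t :=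
  (ContinuousLinearMap.fst ℝ ℝ X).hasFDerivAt.comp_hasDerivWithinAt t h

theorem hasDerivWithinAt_snd {c : ℝ → ℝ × X} {v : ℝ × X} {S : Set ℝ} {t : ℝ}
    (h : HasDerivWithinAt c v S t) : HasDerivWithinAt (fun t => (c t).2) v.2 S t :=
  (ContinuousLinearMap.snd ℝ ℝ X).hasFDerivAt.comp_hasDerivWithinAt t h

theorem continuousOn_speed {a : ℝ → ℝ} (ha : Continuous a) {k : ℕ∞} (hk : 1 ≤ k) {c : ℝ → ℝ × X}
    (hc : ContDiffOn ℝ k c (Icc 0 1)) :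
    ContinuousOn (fun t => √((velocity c t).1 ^ 2 + a (c t).1 * ‖(velocity c t).2‖ ^ 2))
      (Icc 0 1) := by
  have hv := continuousOn_velocity hk hc
  exact Real.continuous_sqrt.comp_continuousOn ((hv.fst.pow 2).add
    ((ha.comp_continuousOn hc.continuousOn.fst).mul (hv.snd.norm.pow 2)))

/-- A geodesic from `p` to `q` stays in every linear subspace containing the spherical parts of its
end points, if these are neither equal nor antipodal. -/
theorem SatisfiesGeodesicEquation.mem_submodule {a : ℝ → ℝ} (ha : ContDiff ℝ ∞ a)
    (hpos : ∀ s, 0 < a s) {p q : ℝ × Metric.sphere (0 : X) 1} {c : ℝ → ℝ × X}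
    (hc : IsCurve ⊤ p q c) (hg : SatisfiesGeodesicEquation a c) (V : Submodule ℝ X)
    (hp : (p.2 : X) ∈ V) (hq : (q.2 : X) ∈ V) (h1 : q.2 ≠ p.2) (h2 : q.2 ≠ -p.2) :
    ∀ t ∈ Icc (0 : ℝ) 1, (c t).2 ∈ V := by
  have hsm : ContDiffOn ℝ ∞ c (Icc 0 1) := hc.contDiffOn
  have hv := contDiffOn_velocity hsm
  have hacc : ContinuousOn (acceleration c) (Icc 0 1) := (contDiffOn_velocity hv).continuousOn
  have hda : Continuous (deriv a) := ha.continuous_deriv (by simp)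
  have hc0 : (c 0).2 = p.2 := by rw [hc.source]
  have hc1 : (c 1).2 = q.2 := by rw [hc.target]
  have hβ : ContinuousOn (fun t => -(deriv a (c t).1 * (velocity c t).1 / a (c t).1)) (Icc 0 1) :=
    (((hda.comp_continuousOn hsm.continuousOn.fst).mul hv.continuousOn.fst).div
      (ha.continuous.comp_continuousOn hsm.continuousOn.fst) fun t _ => (hpos _).ne').neg
  have hα : ContinuousOn (fun t => inner ℝ (c t).2 (acceleration c t).2) (Icc 0 1) :=
    hsm.continuousOn.snd.inner hacc.snd
  set P : Submodule ℝ X := Submodule.span ℝ {(c 0).2, (velocity c 0).2} with hP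
  have : FiniteDimensional ℝ P := FiniteDimensional.span_of_finite ℝ (Set.toFinite _)
  -- For `w ⟂ P` the function `z = ⟨w, φ⟩` satisfies `z'' = ⟨φ, φ_tt⟩ z - (log a)' z'` with zero
  -- initial data, hence vanishes. As `P` is finite-dimensional, `Pᗮᗮ = P`.
  have hmem : ∀ t ∈ Icc (0 : ℝ) 1, (c t).2 ∈ P := by
    intro t ht
    rw [← Submodule.orthogonal_orthogonal P, Submodule.mem_orthogonal]
    intro w hw
    have hw' := (Submodule.mem_orthogonal' P w).1 hw
    refine eq_zero_of_second_order_linear (z := fun t => inner ℝ w (c t).2)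
      (z' := fun t => inner ℝ w (velocity c t).2) (fun t ht => ?_) (fun t ht => ?_) hα hβ
      (hw' _ (Submodule.subset_span (by simp))) (hw' _ (Submodule.subset_span (by simp))) t ht
    · simpa using (hasDerivWithinAt_const t (Icc 0 1) w).inner ℝ
        (hasDerivWithinAt_snd (hasDerivWithinAt_velocity le_top hsm ht))
    · have h := (hasDerivWithinAt_const t (Icc 0 1) w).inner ℝ
        (hasDerivWithinAt_snd (hasDerivWithinAt_velocity le_top hv ht))
      refine h.congr_deriv ?_
      have hs := hg.spherical t ht
      rw [sub_eq_iff_eq_add] at hs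
      change inner ℝ w (acceleration c t).2 + inner ℝ 0 (velocity c t).2 = _
      conv_lhs => rw [hs]
      rw [inner_zero_left, inner_add_right, real_inner_smul_right, real_inner_smul_right]
      ring
  have hle : P ≤ V := by
    rw [hP, Submodule.span_le]
    have h0V : (c 0).2 ∈ V := hc0 ▸ hp
    have h1V : (c 1).2 ∈ V := hc1 ▸ hq
    obtain ⟨x, y, hxy⟩ := Submodule.mem_span_pair.1 (hmem 1 (by simp))
    -- Otherwise the end point is a multiple of the initial point, and unit norms make it equal or
    -- antipodal. Hence the initial velocity is a combination of the two end points.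
    have hy : y ≠ 0 := by
      rintro rfl
      rw [zero_smul, add_zero] at hxy
      have hx : |x| = 1 := by
        have := congrArg norm hxy
        rwa [norm_smul, hc0, hc1, norm_eq_of_mem_sphere, norm_eq_of_mem_sphere, mul_one,
          Real.norm_eq_abs] at this
      rw [hc0, hc1] at hxy
      rcases eq_or_eq_neg_of_abs_eq hx with rfl | rfl
      · exact h1 (Subtype.ext (by simpa using hxy.symm))
      · exact h2 (Subtype.ext (by simpa using hxy.symm))
    have hvV : (velocity c 0).2 = y⁻¹ • ((c 1).2 - x • (c 0).2) := by
      rw [← hxy, add_sub_cancel_left, smul_smul, inv_mul_cancel₀ hy, one_smul]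
    rintro _ (rfl | rfl)
    · exact h0V
    · rw [hvV]
      exact V.smul_mem _ (V.sub_mem h1V (V.smul_mem _ h0V))
  exact fun t ht => hle (hmem t ht)

/-- A minimal geodesic between points with equal spherical part has constant spherical part. -/
theorem IsMinimalGeodesic.snd_eq {a : ℝ → ℝ} (ha : Continuous a)
    (hpos : ∀ s, 0 < a s) {p q : ℝ × Metric.sphere (0 : X) 1} {c : ℝ → ℝ × X}
    (hc : IsMinimalGeodesic a p q c) (h : q.2 = p.2) :
    ∀ t ∈ Icc (0 : ℝ) 1, (c t).2 = p.2 := by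
  have hsm : ContDiffOn ℝ ∞ c (Icc 0 1) := hc.isCurve.contDiffOn
  have hv := continuousOn_velocity le_top hsm
  -- The competitor is the radial segment, of length `|s₁ - s₀|`. The radial part of `c` alone
  -- already needs that length, so any angular motion makes `c` too long.
  set d : ℝ → ℝ × X := fun t => (p.1 + t * (q.1 - p.1), (p.2 : X)) with hd
  have hdv : ∀ t ∈ Icc (0 : ℝ) 1, velocity d t = (q.1 - p.1, 0) := by
    intro t ht
    have : HasDerivAt d (q.1 - p.1, 0) t :=
      (((hasDerivAt_id t).mul_const (q.1 - p.1)).const_add p.1 |>.congr_deriv (one_mul _)).prodMk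
        (hasDerivAt_const t (p.2 : X))
    exact this.hasDerivWithinAt.derivWithin (uniqueDiffOn_Icc zero_lt_one t ht)
  have hdlen : curveLength a d = |q.1 - p.1| := by
    have : curveLength a d = ∫ _ in (0 : ℝ)..1, |q.1 - p.1| := by
      refine intervalIntegral.integral_congr fun t ht => ?_
      rw [uIcc_of_le zero_le_one] at ht
      simp [hdv t ht, Real.sqrt_sq_eq_abs]
    simpa using this
  have hle := hc.minimal d
    { contDiffOn := by
        refine ContDiff.contDiffOn (ContDiff.prodMk ?_ contDiff_const)
        fun_prop
      mem_sphere := fun t _ => p.2.2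
      source := by simp [hd]
      target := by simp [hd, h] }
  rw [hdlen] at hle
  have hint : |q.1 - p.1| ≤ ∫ t in (0 : ℝ)..1, |(velocity c t).1| := by
    have h1 : ∫ t in (0 : ℝ)..1, (velocity c t).1 = (c 1).1 - (c 0).1 := by
      refine intervalIntegral.integral_eq_sub_of_hasDerivAt_of_le zero_le_one
        hsm.continuousOn.fst (fun t ht => ?_)
        (hv.fst.intervalIntegrable_of_Icc zero_le_one)
      exact (hasDerivWithinAt_fst (hasDerivWithinAt_velocity le_top hsm
        (Ioo_subset_Icc_self ht))).hasDerivAt (Icc_mem_nhds ht.1 ht.2)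
    rw [hc.isCurve.source, hc.isCurve.target] at h1
    rw [← h1]
    exact intervalIntegral.abs_integral_le_integral_abs zero_le_one
  have hsp : ∀ t, |(velocity c t).1| ≤
      √((velocity c t).1 ^ 2 + a (c t).1 * ‖(velocity c t).2‖ ^ 2) := fun t => by
    refine Real.abs_le_sqrt ?_
    have := mul_nonneg (hpos (c t).1).le (sq_nonneg ‖(velocity c t).2‖)
    linarith
  have hzero : ∀ t ∈ Icc (0 : ℝ) 1, (velocity c t).2 = 0 := by
    intro t ht
    by_contra hne
    refine absurd (hle.trans hint) (not_le.2 ?_)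
    refine intervalIntegral.integral_lt_integral_of_continuousOn_of_le_of_exists_lt zero_lt_one
      hv.fst.abs (continuousOn_speed ha le_top hsm) (fun t _ => hsp t) ⟨t, ht, ?_⟩
    rw [← Real.sqrt_sq_eq_abs]
    refine Real.sqrt_lt_sqrt (sq_nonneg _) ?_
    have := mul_pos (hpos (c t).1) (pow_pos (norm_pos_iff.2 hne) 2)
    linarith
  have hc0 : (c 0).2 = p.2 := by rw [hc.isCurve.source]
  intro t ht
  rw [← hc0]
  refine constant_of_has_deriv_right_zero hsm.continuousOn.snd (fun x hx => ?_) t ht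
  have := hasDerivWithinAt_snd (hasDerivWithinAt_velocity le_top hsm (Ico_subset_Icc_self hx))
  rw [hzero x (Ico_subset_Icc_self hx)] at this
  exact this.mono_of_mem_nhdsWithin
    (mem_of_superset (Icc_mem_nhdsGE hx.2) (Icc_subset_Icc_left hx.1))

end Sphere

/-! ### Weak sequential compactness of bounded sets. -/

section Weak

/-- Sequential Banach-Alaoglu in the dual of a separable space, carried back by the Riesz
isomorphism. -/
theorem exists_weakly_convergent_subseq {V : Type*} [NormedAddCommGroup V] [InnerProductSpace ℝ V]
    [CompleteSpace V] [TopologicalSpace.SeparableSpace V] {u : ℕ → V} {C : ℝ}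
    (hu : ∀ n, ‖u n‖ ≤ C) :
    ∃ (v : V) (k : ℕ → ℕ), StrictMono k ∧
      ∀ w : V, Tendsto (fun n => inner ℝ (u (k n)) w) atTop (𝓝 (inner ℝ v w)) := by
  obtain ⟨f, -, k, hk, hlim⟩ := WeakDual.isSeqCompact_closedBall ℝ V 0 C
    (x := fun n => StrongDual.toWeakDual (InnerProductSpace.toDual ℝ V (u n)))
    (fun n => by simpa using hu n)
  refine ⟨(InnerProductSpace.toDual ℝ V).symm (WeakDual.toStrongDual f), k, hk, fun w => ?_⟩
  rw [InnerProductSpace.toDual_symm_apply]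
  exact ((WeakDual.eval_continuous w).tendsto f).comp hlim

end Weak

/-! ### Functions in `L²(0,1)` and their primitives. -/

section Primitive

/-- Lebesgue measure on the unit interval. -/
noncomputable abbrev unitVolume : Measure ℝ := volume.restrict (Ioc 0 1)

/-- The Hilbert space `L²(0,1)`. -/
abbrev UnitL2 : Type := Lp ℝ 2 unitVolume

/-- The indicator function of `(0,t]` as an element of `L²(0,1)`. -/
noncomputable def stepL2 (t : ℝ) : UnitL2 :=
  indicatorConstLp 2 (measurableSet_Ioc (a := 0) (b := t)) (measure_ne_top unitVolume _) (1 : ℝ)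

/-- The primitive of `u ∈ L²(0,1)` vanishing at `0`. -/
noncomputable def primitive (u : UnitL2) (t : ℝ) : ℝ := ∫ x in (0 : ℝ)..t, u x ∂unitVolume

/-- Evaluation of the primitive is a bounded functional, so end point conditions survive weak limits
and weak convergence gives pointwise convergence of primitives. -/
theorem inner_stepL2 (u : UnitL2) {t : ℝ} (ht : 0 ≤ t) :
    inner ℝ (stepL2 t) u = primitive u t := by
  rw [stepL2, L2.inner_indicatorConstLp_one, primitive, intervalIntegral.integral_of_le ht]

theorem continuous_primitive (u : UnitL2) : Continuous (primitive u) :=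
  intervalIntegral.continuous_primitive (fun _ _ =>
    ((Lp.memLp u).integrable one_le_two).intervalIntegrable) 0

theorem norm_stepL2_le (t : ℝ) : ‖stepL2 t‖ ≤ 1 := by
  rw [stepL2, norm_indicatorConstLp two_ne_zero ENNReal.ofNat_ne_top, norm_one, one_mul]
  refine Real.rpow_le_one measureReal_nonneg ?_ (by positivity)
  refine (measureReal_mono (subset_univ _)).trans ?_
  simp [measureReal_restrict_apply]

theorem norm_stepL2_one : ‖stepL2 1‖ = 1 := by
  rw [stepL2, norm_indicatorConstLp two_ne_zero ENNReal.ofNat_ne_top]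
  simp [measureReal_restrict_apply]

theorem abs_primitive_le (u : UnitL2) {t : ℝ} (ht : 0 ≤ t) : |primitive u t| ≤ ‖u‖ := by
  rw [← inner_stepL2 u ht]
  refine (abs_real_inner_le_norm _ _).trans ?_
  exact mul_le_of_le_one_left (norm_nonneg _) (norm_stepL2_le t)

theorem primitive_add_smul (u η : UnitL2) (ε : ℝ) {t : ℝ} (ht : 0 ≤ t) :
    primitive (u + ε • η) t = primitive u t + ε * primitive η t := by
  simp only [← inner_stepL2 _ ht, inner_add_right, real_inner_smul_right]

/-- The class in `L²(0,1)` of a function that is continuous on `[0,1]`. -/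
noncomputable def continuousL2 (f : ℝ → ℝ) (hf : ContinuousOn f (Icc 0 1)) : UnitL2 :=
  MemLp.toLp f <| by
    obtain ⟨C, hC⟩ := isCompact_Icc.exists_bound_of_continuousOn hf
    refine MemLp.of_bound ((hf.mono Ioc_subset_Icc_self).aestronglyMeasurable measurableSet_Ioc)
      C ?_
    exact (ae_restrict_mem measurableSet_Ioc).mono fun x hx => hC x (Ioc_subset_Icc_self hx)

theorem continuousL2_coe (f : ℝ → ℝ) (hf : ContinuousOn f (Icc 0 1)) :
    continuousL2 f hf =ᵐ[unitVolume] f := MemLp.coeFn_toLp _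

theorem norm_continuousL2_sq (f : ℝ → ℝ) (hf : ContinuousOn f (Icc 0 1)) :
    ‖continuousL2 f hf‖ ^ 2 = ∫ t in (0 : ℝ)..1, f t ^ 2 := by
  rw [← real_inner_self_eq_norm_sq, L2.inner_def, intervalIntegral.integral_of_le zero_le_one]
  refine integral_congr_ae ?_
  filter_upwards [continuousL2_coe f hf] with x hx
  rw [hx, real_inner_self_eq_norm_sq, Real.norm_eq_abs, sq_abs]

theorem primitive_continuousL2 (f : ℝ → ℝ) (hf : ContinuousOn f (Icc 0 1)) {t : ℝ}
    (ht : t ∈ Icc (0 : ℝ) 1) : primitive (continuousL2 f hf) t = ∫ x in (0 : ℝ)..t, f x := by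
  rw [primitive, intervalIntegral.integral_of_le ht.1, intervalIntegral.integral_of_le ht.1,
    integral_congr_ae (ae_restrict_of_ae (continuousL2_coe f hf)),
    Measure.restrict_restrict measurableSet_Ioc,
    inter_eq_self_of_subset_left (Ioc_subset_Ioc_right ht.2)]

theorem hasDerivAt_integral_tail {g : ℝ → ℝ} (hg : Continuous g) (x : ℝ) :
    HasDerivAt (fun x => ∫ t in x..1, g t) (-g x) x :=
  intervalIntegral.integral_hasDerivAt_left (hg.intervalIntegrable _ _)
    (hg.stronglyMeasurableAtFilter _ _) hg.continuousAt

theorem continuous_integral_tail {g : ℝ → ℝ} (hg : Continuous g) :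
    Continuous fun x => ∫ t in x..1, g t :=
  continuous_iff_continuousAt.2 fun x => (hasDerivAt_integral_tail hg x).continuousAt

/-- Integration by parts for an `L²` function and its primitive. -/
theorem integral_mul_primitive {g : ℝ → ℝ} (hg : Continuous g) (η : UnitL2) :
    ∫ t in (0 : ℝ)..1, g t * primitive η t =
      inner ℝ (continuousL2 (fun x => ∫ t in x..1, g t)
        (continuous_integral_tail hg).continuousOn) η := by
  have hη : Integrable η unitVolume := (Lp.memLp η).integrable one_le_two
  have hgi : Integrable g unitVolume := hg.integrableOn_Ioc
  -- Both sides are the integral of `g t * η x` over the triangle `x ≤ t`; Fubini exchanges the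
  -- order.
  have hprod : Integrable (Function.uncurry fun t x : ℝ =>
      {z : ℝ × ℝ | z.2 ≤ z.1}.indicator (fun z => g z.1 * η z.2) (t, x))
      (unitVolume.prod unitVolume) :=
    (hgi.mul_prod hη).indicator (measurableSet_le measurable_snd measurable_fst)
  have hswap := integral_integral_swap hprod
  rw [intervalIntegral.integral_of_le zero_le_one, L2.inner_def]
  calc ∫ t in Ioc (0 : ℝ) 1, g t * primitive η t
      = ∫ t in Ioc (0 : ℝ) 1, ∫ x in Ioc (0 : ℝ) 1,
          {z : ℝ × ℝ | z.2 ≤ z.1}.indicator (fun z => g z.1 * η z.2) (t, x) := by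
        refine setIntegral_congr_fun measurableSet_Ioc fun t ht => ?_
        have h1 : ∀ x, {z : ℝ × ℝ | z.2 ≤ z.1}.indicator (fun z => g z.1 * η z.2) (t, x) =
            g t * (Iic t).indicator η x := fun x => by
          by_cases hx : x ≤ t <;> simp [indicator, hx]
        simp only [h1]
        rw [integral_const_mul, integral_indicator measurableSet_Iic, primitive,
          intervalIntegral.integral_of_le ht.1.le, Measure.restrict_restrict measurableSet_Iic,
          Measure.restrict_restrict measurableSet_Ioc]
        congr 3
        ext x
        simp only [mem_inter_iff, mem_Ioc, mem_Iic]
        constructor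
        · rintro ⟨⟨h1, h2⟩, -, h3⟩; exact ⟨h2, h1, h3⟩
        · rintro ⟨h1, h2, h3⟩; exact ⟨⟨h2, h1⟩, h2, h3⟩
    _ = _ := hswap
    _ = _ := by
        refine integral_congr_ae ?_
        filter_upwards [continuousL2_coe _ (continuous_integral_tail hg).continuousOn,
          ae_restrict_mem measurableSet_Ioc] with x hG hx
        have h1 : ∀ t, {z : ℝ × ℝ | z.2 ≤ z.1}.indicator (fun z => g z.1 * η z.2) (t, x) =
            (Ici x).indicator g t * η x := fun t => by
          by_cases ht : x ≤ t <;> simp [indicator, ht]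
        simp only [h1]
        rw [hG]
        rw [integral_mul_const, integral_indicator measurableSet_Ici,
          Measure.restrict_restrict measurableSet_Ici, intervalIntegral.integral_of_le hx.2,
          ← integral_Icc_eq_integral_Ioc]
        have : Ici x ∩ Ioc 0 1 = Icc x 1 := by
          ext t
          simp only [mem_inter_iff, mem_Ici, mem_Ioc, mem_Icc]
          exact ⟨fun h => ⟨h.1, h.2.2⟩, fun h => ⟨h.1, hx.1.trans_le h.1, h.2⟩⟩
        rw [this, real_inner_eq_re_inner, mul_comm]
        rfl

end Primitive

/-! ### The reduced variational problem. -/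

section Reduced

/-- `∫₀¹ b(s₀ + ∫₀ᵗ u) dt`. -/
noncomputable def conformalIntegral (b : ℝ → ℝ) (s₀ : ℝ) (u : UnitL2) : ℝ :=
  ∫ t in (0 : ℝ)..1, b (s₀ + primitive u t)

/-- The energy `‖u‖² + θ² / ∫₀¹ b(s₀ + ∫₀ᵗ u) dt` left after minimizing over the angular variable. -/
noncomputable def reducedEnergy (b : ℝ → ℝ) (s₀ θ : ℝ) (u : UnitL2) : ℝ :=
  ‖u‖ ^ 2 + θ ^ 2 / conformalIntegral b s₀ u

variable {b : ℝ → ℝ} {s₀ θ : ℝ}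

theorem conformalIntegral_pos (hb : Continuous b) (hpos : ∀ x, 0 < b x) (u : UnitL2) :
    0 < conformalIntegral b s₀ u :=
  intervalIntegral.intervalIntegral_pos_of_pos
    ((hb.comp (continuous_const.add (continuous_primitive u))).intervalIntegrable _ _)
    (fun _ => hpos _) zero_lt_one

/-- The primitives converge pointwise and stay within distance `C` of `0`, so `b` is evaluated on a
compact ball and dominated convergence applies. -/
theorem tendsto_conformalIntegral (hb : Continuous b) {u : ℕ → UnitL2} {v : UnitL2} {C : ℝ}
    (hu : ∀ n, ‖u n‖ ≤ C)
    (hlim : ∀ w : UnitL2, Tendsto (fun n => inner ℝ (u n) w) atTop (𝓝 (inner ℝ v w))) :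
    Tendsto (fun n => conformalIntegral b s₀ (u n)) atTop (𝓝 (conformalIntegral b s₀ v)) := by
  obtain ⟨B, hB⟩ := (isCompact_closedBall s₀ C).exists_bound_of_continuousOn hb.continuousOn
  refine intervalIntegral.tendsto_integral_filter_of_dominated_convergence (fun _ => B) ?_ ?_ ?_ ?_
  · exact Eventually.of_forall fun n =>
      (hb.comp (continuous_const.add (continuous_primitive (u n)))).aestronglyMeasurable
  · refine Eventually.of_forall fun n => Eventually.of_forall fun t ht => hB _ ?_
    rw [uIoc_of_le zero_le_one] at ht
    rw [Metric.mem_closedBall, Real.dist_eq, add_sub_cancel_left]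
    exact (abs_primitive_le _ ht.1.le).trans (hu n)
  · exact intervalIntegrable_const
  · refine Eventually.of_forall fun t ht => ?_
    rw [uIoc_of_le zero_le_one] at ht
    refine (hb.tendsto _).comp (tendsto_const_nhds.add ?_)
    have := hlim (stepL2 t)
    simpa only [real_inner_comm (stepL2 t), inner_stepL2 _ ht.1.le] using this

theorem exists_reducedEnergy_minimizer (hb : Continuous b) (hpos : ∀ x, 0 < b x) (Δ : ℝ) :
    ∃ u : UnitL2, primitive u 1 = Δ ∧
      ∀ v : UnitL2, primitive v 1 = Δ → reducedEnergy b s₀ θ u ≤ reducedEnergy b s₀ θ v := by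
  set A : Set ℝ := reducedEnergy b s₀ θ '' {v | primitive v 1 = Δ} with hA
  have hnonneg : ∀ v, ‖v‖ ^ 2 ≤ reducedEnergy b s₀ θ v := fun v =>
    le_add_of_nonneg_right (div_nonneg (sq_nonneg _) (conformalIntegral_pos hb hpos v).le)
  have hne : A.Nonempty := by
    refine ⟨_, Δ • stepL2 1, ?_, rfl⟩
    rw [mem_ofPred_eq, ← inner_stepL2 _ zero_le_one, real_inner_smul_right,
      real_inner_self_eq_norm_sq, norm_stepL2_one]
    ring
  have hbdd : BddBelow A := ⟨0, by
    rintro _ ⟨v, -, rfl⟩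
    exact (sq_nonneg _).trans (hnonneg v)⟩
  obtain ⟨x, hanti, hx, hxA⟩ := exists_seq_tendsto_sInf hne hbdd
  choose u hu hux using hxA
  -- The values of the minimizing sequence decrease, so the first one bounds all the norms.
  have hbound : ∀ n, ‖u n‖ ≤ √(x 0) := fun n => by
    refine Real.le_sqrt_of_sq_le ((hnonneg _).trans ?_)
    rw [hux]
    exact hanti (Nat.zero_le n)
  have : Fact ((2 : ENNReal) ≠ ⊤) := ⟨ENNReal.ofNat_ne_top⟩
  have : SecondCountableTopology UnitL2 := Lp.SecondCountableTopology
  obtain ⟨v, k, hk, hlim⟩ := exists_weakly_convergent_subseq hbound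
  refine ⟨v, ?_, fun w hw => ?_⟩
  · have h1 := hlim (stepL2 1)
    simp only [real_inner_comm (stepL2 1), inner_stepL2 _ zero_le_one] at h1
    refine tendsto_nhds_unique h1 ?_
    have : (fun n => primitive (u (k n)) 1) = fun _ => Δ := funext fun n => hu (k n)
    rw [this]
    exact tendsto_const_nhds
  · have hlow : Tendsto (fun n => 2 * inner ℝ (u (k n)) v - ‖v‖ ^ 2 +
        θ ^ 2 / conformalIntegral b s₀ (u (k n))) atTop (𝓝 (reducedEnergy b s₀ θ v)) := by
      have h1 := (((hlim v).const_mul 2).sub_const (‖v‖ ^ 2)).add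
        ((tendsto_const_nhds (x := θ ^ 2)).div
          (tendsto_conformalIntegral (s₀ := s₀) hb (fun n => hbound (k n)) hlim)
          (conformalIntegral_pos hb hpos v).ne')
      have h2 : reducedEnergy b s₀ θ v =
          2 * inner ℝ v v - ‖v‖ ^ 2 + θ ^ 2 / conformalIntegral b s₀ v := by
        rw [reducedEnergy, real_inner_self_eq_norm_sq]
        ring
      rw [h2]
      exact h1
    have hup := hx.comp hk.tendsto_atTop
    refine (le_of_tendsto_of_tendsto' hlow hup fun n => ?_).trans (csInf_le hbdd ⟨w, hw, rfl⟩)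
    rw [Function.comp_apply, ← hux, reducedEnergy]
    have := norm_sub_sq_real (u (k n)) v
    nlinarith [sq_nonneg ‖u (k n) - v‖]

theorem hasDerivAt_conformalIntegral (hb : ContDiff ℝ ∞ b) (u η : UnitL2) :
    HasDerivAt (fun ε : ℝ => conformalIntegral b s₀ (u + ε • η))
      (∫ t in (0 : ℝ)..1, deriv b (s₀ + primitive u t) * primitive η t) 0 := by
  have hdb : Continuous (deriv b) := hb.continuous_deriv (by simp)
  have hu := continuous_primitive u
  have hη := continuous_primitive η
  -- Restricting `ε` to `[-1,1]` puts the differentiated integrand on a compact set, where it has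
  -- the constant bound needed to differentiate under the integral.
  have hF' : Continuous fun z : ℝ × ℝ =>
      deriv b (s₀ + (primitive u z.2 + z.1 * primitive η z.2)) * primitive η z.2 := by
    fun_prop
  obtain ⟨B, hB⟩ := ((isCompact_closedBall (0 : ℝ) 1).prod
    (isCompact_Icc (a := (0 : ℝ)) (b := 1))).exists_bound_of_continuousOn hF'.continuousOn
  have key := (intervalIntegral.hasDerivAt_integral_of_dominated_loc_of_deriv_le
    (μ := volume) (a := 0) (b := 1) (x₀ := (0 : ℝ)) (s := Metric.closedBall 0 1)
    (F := fun ε t => b (s₀ + (primitive u t + ε * primitive η t)))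
    (F' := fun ε t => deriv b (s₀ + (primitive u t + ε * primitive η t)) * primitive η t)
    (bound := fun _ => B) (Metric.closedBall_mem_nhds _ one_pos)
    (Eventually.of_forall fun ε => (by
      have := hb.continuous
      fun_prop : Continuous fun t =>
        b (s₀ + (primitive u t + ε * primitive η t))).aestronglyMeasurable)
    ((by
      have := hb.continuous
      fun_prop : Continuous fun t =>
        b (s₀ + (primitive u t + 0 * primitive η t))).intervalIntegrable _ _)
    ((by fun_prop : Continuous fun t => deriv b (s₀ + (primitive u t + 0 * primitive η t)) *
      primitive η t).aestronglyMeasurable)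
    (Eventually.of_forall fun t ht ε hε => hB (ε, t) ⟨hε, by
      rw [uIoc_of_le zero_le_one] at ht
      exact Ioc_subset_Icc_self ht⟩)
    intervalIntegrable_const
    (Eventually.of_forall fun t _ ε _ => ?_)).2
  · simp only [zero_mul, add_zero] at key
    refine key.congr_of_eventuallyEq (Eventually.of_forall fun ε => ?_)
    refine intervalIntegral.integral_congr fun t ht => ?_
    rw [uIcc_of_le zero_le_one] at ht
    simp only [primitive_add_smul u η ε ht.1]
  · have hbd := ((hb.differentiable (by simp)) (s₀ + (primitive u t + ε * primitive η t))).hasDerivAt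
    exact hbd.comp ε ((((hasDerivAt_id ε).mul_const (primitive η t)).const_add
      (primitive u t)).const_add s₀ |>.congr_deriv (one_mul _))

/-- The first variation of the reduced energy. -/
theorem hasDerivAt_reducedEnergy (hb : ContDiff ℝ ∞ b) (hpos : ∀ x, 0 < b x) (u η : UnitL2) :
    HasDerivAt (fun ε : ℝ => reducedEnergy b s₀ θ (u + ε • η))
      (2 * inner ℝ u η - (θ / conformalIntegral b s₀ u) ^ 2 *
        ∫ t in (0 : ℝ)..1, deriv b (s₀ + primitive u t) * primitive η t) 0 := by
  have hK := (conformalIntegral_pos (s₀ := s₀) hb.continuous hpos u).ne'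
  have hK0 : conformalIntegral b s₀ (u + (0 : ℝ) • η) ≠ 0 := by simpa using hK
  have h1 := ((hasDerivAt_id (0 : ℝ)).smul_const η).const_add u
  have h2 := h1.norm_sq.add
    ((hasDerivAt_const (0 : ℝ) (θ ^ 2)).div (hasDerivAt_conformalIntegral hb u η) hK0)
  refine h2.congr_deriv ?_
  simp only [id_eq, zero_smul, add_zero, one_smul, zero_mul, zero_sub]
  field_simp
  ring

/-- The Euler-Lagrange equation: a minimizer of the reduced energy is, up to an additive constant,
the primitive of a continuous function. -/
theorem eq_continuousL2_of_isMin (hb : ContDiff ℝ ∞ b) (hpos : ∀ x, 0 < b x) {Δ : ℝ}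
    {u : UnitL2} (hu : primitive u 1 = Δ)
    (hmin : ∀ v : UnitL2, primitive v 1 = Δ → reducedEnergy b s₀ θ u ≤ reducedEnergy b s₀ θ v)
    {g : ℝ → ℝ} (hg : Continuous g)
    (hgu : ∀ t, g t =
      -((θ / conformalIntegral b s₀ u) ^ 2 * deriv b (s₀ + primitive u t))) :
    ∃ l : ℝ, (u : ℝ → ℝ) =ᵐ[unitVolume] fun x => (1 / 2) * (l - ∫ t in x..1, g t) := by
  set G := continuousL2 (fun x => ∫ t in x..1, g t) (continuous_integral_tail hg).continuousOn
    with hG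
  have hcrit : ∀ η : UnitL2, primitive η 1 = 0 → inner ℝ ((2 : ℝ) • u + G) η = 0 := by
    intro η hη
    have hloc : IsLocalMin (fun ε : ℝ => reducedEnergy b s₀ θ (u + ε • η)) 0 := by
      refine Eventually.of_forall fun ε => ?_
      simp only [zero_smul, add_zero]
      refine hmin _ ?_
      rw [primitive_add_smul _ _ _ zero_le_one, hu, hη, mul_zero, add_zero]
    have h0 := hloc.hasDerivAt_eq_zero (hasDerivAt_reducedEnergy hb hpos u η)
    rw [inner_add_left, real_inner_smul_left, hG, ← integral_mul_primitive hg η]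
    refine Eq.trans ?_ h0
    simp only [hgu, neg_mul, mul_assoc]
    rw [intervalIntegral.integral_neg, intervalIntegral.integral_const_mul]
    ring
  set z := (2 : ℝ) • u + G with hz
  set e := stepL2 1 with he
  -- `2u + G` is orthogonal to every `η` with zero integral, that is, to the orthogonal complement
  -- of the constant `e`; so it is a multiple of `e`.
  have hη : z - inner ℝ e z • e = 0 := by
    have h1 : inner ℝ e (z - inner ℝ e z • e) = 0 := by
      rw [inner_sub_right, real_inner_smul_right, real_inner_self_eq_norm_sq, he, norm_stepL2_one]
      ring
    have h2 := hcrit (z - inner ℝ e z • e) (by rw [← inner_stepL2 _ zero_le_one]; exact h1)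
    rw [← inner_self_eq_zero (𝕜 := ℝ), inner_sub_left, h2, real_inner_smul_left, h1]
    ring
  refine ⟨inner ℝ e z, ?_⟩
  have hu' : u = (1 / 2 : ℝ) • (inner ℝ e z • e - G) := by
    rw [← sub_eq_zero.1 hη, hz, add_sub_cancel_right, smul_smul]
    norm_num
  have he1 : (e : ℝ → ℝ) =ᵐ[unitVolume] fun _ => 1 := by
    have h1 : (e : ℝ → ℝ) =ᵐ[unitVolume] (Ioc (0 : ℝ) 1).indicator fun _ => 1 :=
      indicatorConstLp_coeFn
    filter_upwards [h1, ae_restrict_mem measurableSet_Ioc] with x hx hx1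
    rw [hx, indicator_of_mem hx1]
  generalize inner ℝ e z = l at hu'
  filter_upwards [he1, continuousL2_coe _ (continuous_integral_tail hg).continuousOn,
    Lp.coeFn_smul (1 / 2 : ℝ) (l • e - G), Lp.coeFn_sub (l • e) G, Lp.coeFn_smul l e]
    with x h1 h2 h3 h4 h5
  rw [hu', h3, Pi.smul_apply, h4, Pi.sub_apply, h5, Pi.smul_apply, h1, h2]
  simp

end Reduced

/-! ### From the reduced minimizer to the optimal radial profile. -/

section Profile

/-- The reduced energy bounds from below the energy of a curve in the warped product. -/
theorem reducedEnergy_le {a : ℝ → ℝ} (ha : Continuous a) (hpos : ∀ s, 0 < a s) {s₀ s₁ θ : ℝ}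
    (hθ : 0 ≤ θ) {u : UnitL2}
    (hmin : ∀ v : UnitL2, primitive v 1 = s₁ - s₀ →
      reducedEnergy (fun x => (a x)⁻¹) s₀ θ u ≤ reducedEnergy (fun x => (a x)⁻¹) s₀ θ v)
    {σ σ' w : ℝ → ℝ} (hσ : ContinuousOn σ (Icc 0 1))
    (hd : ∀ t ∈ Ioo (0 : ℝ) 1, HasDerivAt σ (σ' t) t) (hσ' : ContinuousOn σ' (Icc 0 1))
    (hw : ContinuousOn w (Icc 0 1)) (h0 : σ 0 = s₀) (h1 : σ 1 = s₁)
    (hθw : θ ≤ ∫ t in (0 : ℝ)..1, w t) :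
    reducedEnergy (fun x => (a x)⁻¹) s₀ θ u ≤
      ∫ t in (0 : ℝ)..1, (σ' t ^ 2 + a (σ t) * w t ^ 2) := by
  set b : ℝ → ℝ := fun x => (a x)⁻¹ with hbdef
  have hb : Continuous b := ha.inv₀ fun x => (hpos x).ne'
  have hbpos : ∀ x, 0 < b x := fun x => inv_pos.2 (hpos x)
  set v := continuousL2 σ' hσ' with hv
  have hprim : ∀ t ∈ Icc (0 : ℝ) 1, s₀ + primitive v t = σ t := by
    intro t ht
    rw [hv, primitive_continuousL2 σ' hσ' ht,
      intervalIntegral.integral_eq_sub_of_hasDerivAt_of_le ht.1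
        (hσ.mono (Icc_subset_Icc_right ht.2))
        (fun x hx => hd x ⟨hx.1, hx.2.trans_le ht.2⟩)
        ((hσ'.mono (Icc_subset_Icc_right ht.2)).intervalIntegrable_of_Icc ht.1), h0]
    ring
  refine (hmin v ?_).trans ?_
  · rw [← h1, ← hprim 1 (by simp)]
    ring
  have hK := conformalIntegral_pos (s₀ := s₀) hb hbpos v
  have hKeq : conformalIntegral b s₀ v = ∫ t in (0 : ℝ)..1, b (σ t) := by
    refine intervalIntegral.integral_congr fun t ht => ?_
    rw [uIcc_of_le zero_le_one] at ht
    simp only [hprim t ht]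
  set K := conformalIntegral b s₀ v with hKdef
  have haσ : ContinuousOn (fun t => a (σ t)) (Icc 0 1) := ha.comp_continuousOn hσ
  have hbσ : ContinuousOn (fun t => b (σ t)) (Icc 0 1) := hb.comp_continuousOn hσ
  have hint : ∀ {f : ℝ → ℝ}, ContinuousOn f (Icc 0 1) → IntervalIntegrable f volume 0 1 :=
    fun hf => hf.intervalIntegrable_of_Icc zero_le_one
  have hlow : θ ^ 2 / K ≤ ∫ t in (0 : ℝ)..1, a (σ t) * w t ^ 2 := by
    have hpt : ∫ t in (0 : ℝ)..1, (2 * (θ / K) * w t - (θ / K) ^ 2 * b (σ t)) ≤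
        ∫ t in (0 : ℝ)..1, a (σ t) * w t ^ 2 := by
      refine intervalIntegral.integral_mono_on zero_le_one
        (hint ((continuousOn_const.mul hw).sub (continuousOn_const.mul hbσ)))
        (hint (haσ.mul (hw.pow 2))) fun t _ => ?_
      have hA := hpos (σ t)
      -- Completing the square with the optimal constant `θ / K` proves the weighted Cauchy-Schwarz
      -- inequality; equality holds for `a w = θ / K`.
      have : a (σ t) * w t ^ 2 - (2 * (θ / K) * w t - (θ / K) ^ 2 * b (σ t)) =
          b (σ t) * (a (σ t) * w t - θ / K) ^ 2 := by
        simp only [hbdef]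
        field_simp
        ring
      nlinarith [mul_nonneg (hbpos (σ t)).le (sq_nonneg (a (σ t) * w t - θ / K))]
    rw [intervalIntegral.integral_sub (f := fun t => 2 * (θ / K) * w t)
      (g := fun t => (θ / K) ^ 2 * b (σ t)) (hint (continuousOn_const.mul hw))
      (hint (continuousOn_const.mul hbσ)), intervalIntegral.integral_const_mul,
      intervalIntegral.integral_const_mul, ← hKeq] at hpt
    refine le_trans ?_ hpt
    have h2 : θ ^ 2 / K = 2 * (θ / K) * θ - (θ / K) ^ 2 * K := by
      field_simp
      ring
    have h3 := mul_le_mul_of_nonneg_left hθw (mul_nonneg zero_le_two (div_nonneg hθ hK.le))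
    linarith
  rw [intervalIntegral.integral_add (f := fun t => σ' t ^ 2) (g := fun t => a (σ t) * w t ^ 2)
    (hint (hσ'.pow 2)) (hint (haσ.mul (hw.pow 2))),
    reducedEnergy, hv, norm_continuousL2_sq]
  exact add_le_add le_rfl hlow

/-- The radial profile of an energy minimizer: a solution of the radial geodesic equation with
angular velocity `κ / a`, whose energy is at most that of every competitor. -/
theorem exists_optimal_profile {a : ℝ → ℝ} (ha : ContDiff ℝ ∞ a) (hpos : ∀ s, 0 < a s)
    (s₀ s₁ : ℝ) {θ : ℝ} (hθ : 0 ≤ θ) :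
    ∃ (S S' : ℝ → ℝ) (κ : ℝ), (∀ t, HasDerivAt S (S' t) t) ∧ Continuous S' ∧
      S 0 = s₀ ∧ S 1 = s₁ ∧
      (∀ t ∈ Icc (0 : ℝ) 1, HasDerivAt S' ((1 / 2) * deriv a (S t) * (κ / a (S t)) ^ 2) t) ∧
      (∫ t in (0 : ℝ)..1, κ / a (S t)) = θ ∧
      ∀ σ σ' w : ℝ → ℝ, ContinuousOn σ (Icc 0 1) →
        (∀ t ∈ Ioo (0 : ℝ) 1, HasDerivAt σ (σ' t) t) → ContinuousOn σ' (Icc 0 1) →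
        ContinuousOn w (Icc 0 1) → σ 0 = s₀ → σ 1 = s₁ → θ ≤ (∫ t in (0 : ℝ)..1, w t) →
        (∫ t in (0 : ℝ)..1, (S' t ^ 2 + a (S t) * (κ / a (S t)) ^ 2)) ≤
          ∫ t in (0 : ℝ)..1, (σ' t ^ 2 + a (σ t) * w t ^ 2) := by
  set b : ℝ → ℝ := fun x => (a x)⁻¹ with hbdef
  have hb : ContDiff ℝ ∞ b := ha.inv fun x => (hpos x).ne'
  have hbpos : ∀ x, 0 < b x := fun x => inv_pos.2 (hpos x)
  have hdb : ∀ x, deriv b x = -deriv a x / a x ^ 2 := fun x =>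
    (((ha.differentiable (by simp)) x).hasDerivAt.inv (hpos x).ne').deriv
  obtain ⟨u, hu1, hmin⟩ := exists_reducedEnergy_minimizer (s₀ := s₀) (θ := θ) hb.continuous hbpos
    (s₁ - s₀)
  set K := conformalIntegral b s₀ u with hK
  have hKpos : 0 < K := conformalIntegral_pos hb.continuous hbpos u
  set g : ℝ → ℝ := fun t => -((θ / K) ^ 2 * deriv b (s₀ + primitive u t)) with hgdef
  have hg : Continuous g := by
    have h1 : Continuous (deriv b) := hb.continuous_deriv (by simp)
    have h2 := continuous_primitive u
    fun_prop
  obtain ⟨l, hul⟩ := eq_continuousL2_of_isMin hb hbpos hu1 hmin hg fun t => rfl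
  set S' : ℝ → ℝ := fun x => (1 / 2) * (l - ∫ t in x..1, g t) with hS'
  have hS'c : Continuous S' :=
    continuous_const.mul (continuous_const.sub (continuous_integral_tail hg))
  have hS'd : ∀ t, HasDerivAt S' ((1 / 2) * g t) t := fun t =>
    (((hasDerivAt_integral_tail hg t).const_sub l).const_mul (1 / 2 : ℝ)).congr_deriv (by ring)
  -- The Euler-Lagrange equation identifies `u` with the `C¹` function `S'`. Then `S'' = -½ κ²
  -- b'(S)` with `b = 1/a` and `κ = θ / K`, which is the radial geodesic equation.
  have huS : u = continuousL2 S' hS'c.continuousOn :=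
    Lp.ext (hul.trans (continuousL2_coe _ _).symm)
  set S : ℝ → ℝ := fun t => s₀ + ∫ x in (0 : ℝ)..t, S' x with hS
  have hSu : ∀ t ∈ Icc (0 : ℝ) 1, s₀ + primitive u t = S t := fun t ht => by
    rw [huS, primitive_continuousL2 _ _ ht]
  have hSd : ∀ t, HasDerivAt S (S' t) t := fun t =>
    (intervalIntegral.integral_hasDerivAt_right (hS'c.intervalIntegrable _ _)
      (hS'c.stronglyMeasurableAtFilter _ _) hS'c.continuousAt).const_add s₀
  have hSc : Continuous S := continuous_iff_continuousAt.2 fun t => (hSd t).continuousAt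
  have hKeq : ∫ t in (0 : ℝ)..1, b (S t) = K := by
    refine intervalIntegral.integral_congr fun t ht => ?_
    rw [uIcc_of_le zero_le_one] at ht
    simp only [hSu t ht]
  refine ⟨S, S', θ / K, hSd, hS'c, by simp [hS], ?_, fun t ht => ?_, ?_, ?_⟩
  · rw [← hSu 1 (by simp), hu1]
    ring
  · refine (hS'd t).congr_deriv ?_
    simp only [hgdef, hdb, hSu t ht]
    ring
  · simp only [div_eq_mul_inv (θ / K)]
    rw [intervalIntegral.integral_const_mul, hKeq, div_mul_cancel₀ _ hKpos.ne']
  · intro σ σ' w hσ hd hσ' hw h0 h1 hθw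
    refine le_of_eq_of_le ?_
      (reducedEnergy_le ha.continuous hpos hθ hmin hσ hd hσ' hw h0 h1 hθw)
    have hpt : ∀ t, a (S t) * (θ / K / a (S t)) ^ 2 = (θ / K) ^ 2 * b (S t) := fun t => by
      have := (hpos (S t)).ne'
      simp only [hbdef]
      field_simp
    simp only [hpt]
    rw [intervalIntegral.integral_add (f := fun t => S' t ^ 2)
      (g := fun t => (θ / K) ^ 2 * b (S t)) ((hS'c.pow 2).intervalIntegrable _ _)
      ((continuous_const.mul (hb.continuous.comp hSc)).intervalIntegrable _ _),
      intervalIntegral.integral_const_mul, hKeq]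
    have h2 : reducedEnergy b s₀ θ u = ‖u‖ ^ 2 + θ ^ 2 / K := rfl
    have h3 : ‖u‖ ^ 2 = ∫ t in (0 : ℝ)..1, S' t ^ 2 :=
      (congrArg (‖·‖ ^ 2) huS).trans (norm_continuousL2_sq _ _)
    rw [h2, h3]
    congr 1
    field_simp

end Profile

/-! ### Minimal geodesics along great circles. -/

section Existence

variable {X : Type*} [NormedAddCommGroup X] [InnerProductSpace ℝ X]

/-- A `C¹` curve can be reparametrized to have speed at most its length plus `ε`. -/
theorem exists_reparametrization {a : ℝ → ℝ} (ha : Continuous a) (hpos : ∀ s, 0 < a s)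
    {p q : ℝ × Metric.sphere (0 : X) 1} {d : ℝ → ℝ × X} (hd : IsCurve 1 p q d)
    {ε : ℝ} (hε : 0 < ε) :
    ∃ D D' : ℝ → ℝ × X, ContinuousOn D (Icc 0 1) ∧
      (∀ t ∈ Ioo (0 : ℝ) 1, HasDerivAt D (D' t) t) ∧ ContinuousOn D' (Icc 0 1) ∧
      D 0 = d 0 ∧ D 1 = d 1 ∧ (∀ t ∈ Icc (0 : ℝ) 1, ‖(D t).2‖ = 1) ∧
      ∀ t ∈ Icc (0 : ℝ) 1, (D' t).1 ^ 2 + a (D t).1 * ‖(D' t).2‖ ^ 2 ≤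
        (curveLength a d + ε) ^ 2 := by
  have hsm := hd.contDiffOn
  set v : ℝ → ℝ := fun t => √((velocity d t).1 ^ 2 + a (d t).1 * ‖(velocity d t).2‖ ^ 2) with hv
  have hvc : ContinuousOn v (Icc 0 1) := continuousOn_speed ha le_rfl hsm
  -- The speed is extended constantly beyond `[0,1]`, and `ε` is added to it, so that the arc length
  -- `T` has positive derivative everywhere, even where the curve stops, and is a bijection of `ℝ`.
  set V : ℝ → ℝ := fun t => v (projIcc 0 1 zero_le_one t) with hV
  have hVc : Continuous V := (continuousOn_iff_continuous_domRestrict.1 hvc).comp continuous_projIcc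
  have hV0 : ∀ t, 0 ≤ V t := fun t => Real.sqrt_nonneg _
  have hVv : ∀ t ∈ Icc (0 : ℝ) 1, V t = v t := fun t ht => by
    simp only [hV, projIcc_of_mem zero_le_one ht]
  set T : ℝ → ℝ := fun t => ∫ x in (0 : ℝ)..t, (V x + ε) with hT
  have hVε : Continuous fun x => V x + ε := hVc.add continuous_const
  have hTd : ∀ t, HasDerivAt T (V t + ε) t := fun t =>
    intervalIntegral.integral_hasDerivAt_right (hVε.intervalIntegrable _ _)
      (hVε.stronglyMeasurableAtFilter _ _) hVε.continuousAt
  have hTc : Continuous T := continuous_iff_continuousAt.2 fun t => (hTd t).continuousAt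
  have hTm : StrictMono T := strictMono_of_hasDerivAt_pos hTd fun t => by
    have := hV0 t
    positivity
  have hTsub : Monotone fun t => T t - ε * t := by
    refine monotone_of_hasDerivAt_nonneg (f' := V) (fun t => ?_) hV0
    exact ((hTd t).sub ((hasDerivAt_id t).const_mul ε)).congr_deriv (by ring)
  have hT0 : T 0 = 0 := intervalIntegral.integral_same
  have hTsurj : Function.Surjective T := by
    refine hTc.surjective ?_ ?_
    · refine tendsto_atTop_mono' _ ?_ (tendsto_id.const_mul_atTop hε)
      filter_upwards [eventually_ge_atTop 0] with t ht
      have := hTsub ht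
      simp only [hT0, mul_zero, sub_zero] at this
      simpa using this
    · refine tendsto_atBot_mono' _ ?_ (tendsto_id.const_mul_atBot hε)
      filter_upwards [eventually_le_atBot 0] with t ht
      have := hTsub ht
      simp only [hT0, mul_zero, sub_zero] at this
      simpa using this
  set τ := hTm.orderIsoOfSurjective T hTsurj with hτ
  have hTτ : ∀ y, T (τ.symm y) = y := fun y => τ.apply_symm_apply y
  have hτT : ∀ y, τ.symm (T y) = y := fun y => τ.symm_apply_apply y
  have hτd : ∀ y, HasDerivAt τ.symm (V (τ.symm y) + ε)⁻¹ y := fun y =>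
    HasDerivAt.of_local_left_inverse τ.symm.continuous.continuousAt (hTd _)
      (by have := hV0 (τ.symm y); positivity) (Eventually.of_forall hTτ)
  set l := curveLength a d + ε with hl
  have hT1 : T 1 = l := by
    have : T 1 = (∫ x in (0 : ℝ)..1, V x) + ∫ _ in (0 : ℝ)..1, ε :=
      intervalIntegral.integral_add (hVc.intervalIntegrable _ _) intervalIntegrable_const
    rw [this, hl, curveLength]
    congr 1
    · refine intervalIntegral.integral_congr fun t ht => ?_
      rw [uIcc_of_le zero_le_one] at ht
      exact hVv t ht
    · simp
  have hlpos : 0 < l := by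
    rw [← hT1, ← hT0]
    exact hTm zero_lt_one
  set ρ : ℝ → ℝ := fun x => τ.symm (l * x) with hρ
  have hρ0 : ρ 0 = 0 := by
    have := hτT 0
    rw [hT0] at this
    simp only [hρ, mul_zero, this]
  have hρ1 : ρ 1 = 1 := by
    have := hτT 1
    rw [hT1] at this
    simp only [hρ, mul_one, this]
  have hρm : StrictMono ρ := fun x y hxy =>
    τ.symm.strictMono (mul_lt_mul_of_pos_left hxy hlpos)
  have hρd : ∀ x, HasDerivAt ρ (l * (V (ρ x) + ε)⁻¹) x := fun x =>
    ((hτd (l * x)).comp x ((hasDerivAt_id x).const_mul l)).congr_deriv (by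
      simp only [hρ]; ring)
  have hρc : Continuous ρ := continuous_iff_continuousAt.2 fun t => (hρd t).continuousAt
  have hρIcc : MapsTo ρ (Icc 0 1) (Icc 0 1) := fun x hx =>
    ⟨hρ0 ▸ hρm.monotone hx.1, hρ1 ▸ hρm.monotone hx.2⟩
  have hρIoo : MapsTo ρ (Ioo 0 1) (Ioo 0 1) := fun x hx => ⟨hρ0 ▸ hρm hx.1, hρ1 ▸ hρm hx.2⟩
  have hne : ∀ x, V (ρ x) + ε ≠ 0 := fun x => by
    have := hV0 (ρ x)
    positivity
  refine ⟨fun x => d (ρ x), fun x => (l * (V (ρ x) + ε)⁻¹) • velocity d (ρ x),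
    hsm.continuousOn.comp hρc.continuousOn hρIcc, fun t ht => ?_, ?_, congrArg d hρ0, congrArg d hρ1,
    fun t ht => by simpa using hd.mem_sphere _ (hρIcc ht), fun t ht => ?_⟩
  · have h := hρIoo ht
    exact ((hasDerivWithinAt_velocity le_rfl hsm (Ioo_subset_Icc_self h)).hasDerivAt
      (Icc_mem_nhds h.1 h.2)).scomp t (hρd t)
  · have h1 : Continuous fun x => l * (V (ρ x) + ε)⁻¹ :=
      continuous_const.mul ((hVε.comp hρc).inv₀ hne)
    exact h1.continuousOn.smul ((continuousOn_velocity le_rfl hsm).comp hρc.continuousOn hρIcc)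
  · have hvρ : V (ρ t) ^ 2 = (velocity d (ρ t)).1 ^ 2 +
        a (d (ρ t)).1 * ‖(velocity d (ρ t)).2‖ ^ 2 := by
      rw [hVv _ (hρIcc ht)]
      refine Real.sq_sqrt ?_
      have := (hpos (d (ρ t)).1).le
      positivity
    have hV' := hV0 (ρ t)
    simp only [Prod.smul_fst, Prod.smul_snd, smul_eq_mul, norm_smul, Real.norm_eq_abs, mul_pow,
      sq_abs]
    calc _ = l ^ 2 * ((V (ρ t) + ε)⁻¹ ^ 2 * V (ρ t) ^ 2) := by rw [hvρ]; ring
      _ ≤ l ^ 2 * 1 := by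
        refine mul_le_mul_of_nonneg_left ?_ (sq_nonneg l)
        rw [← mul_pow]
        refine pow_le_one₀ (by positivity) ?_
        rw [inv_mul_le_iff₀ (by positivity)]
        linarith
      _ = l ^ 2 := mul_one _

/-- Bootstrapping: if `S` and `S'` are `C^n`, so are their derivatives `S'` and `F ∘ S`. -/
theorem contDiffOn_of_second_order {S S' F : ℝ → ℝ} (hF : ContDiff ℝ ∞ F)
    (h1 : ∀ t ∈ Icc (0 : ℝ) 1, HasDerivWithinAt S (S' t) (Icc 0 1) t)
    (h2 : ∀ t ∈ Icc (0 : ℝ) 1, HasDerivWithinAt S' (F (S t)) (Icc 0 1) t) :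
    ContDiffOn ℝ ∞ S (Icc 0 1) := by
  have hu : UniqueDiffOn ℝ (Icc (0 : ℝ) 1) := uniqueDiffOn_Icc zero_lt_one
  have key : ∀ n : ℕ, ContDiffOn ℝ n S (Icc 0 1) ∧ ContDiffOn ℝ n S' (Icc 0 1) := by
    intro n
    induction n with
    | zero =>
      simp only [Nat.cast_zero, contDiffOn_zero]
      exact ⟨fun t ht => (h1 t ht).continuousWithinAt, fun t ht => (h2 t ht).continuousWithinAt⟩
    | succ n ih =>
      have hFn : ContDiff ℝ n F := hF.of_le (by exact_mod_cast le_top)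
      push_cast
      rw [contDiffOn_succ_iff_derivWithin hu, contDiffOn_succ_iff_derivWithin hu]
      refine ⟨⟨fun t ht => (h1 t ht).differentiableWithinAt, by simp, ?_⟩,
        ⟨fun t ht => (h2 t ht).differentiableWithinAt, by simp, ?_⟩⟩
      · exact ih.2.congr fun t ht => (h1 t ht).derivWithin (hu t ht)
      · exact (hFn.comp_contDiffOn ih.1).congr fun t ht => (h2 t ht).derivWithin (hu t ht)
  exact contDiffOn_infty.2 fun n => (key n).1

theorem sq_integral_le_integral_sq {f : ℝ → ℝ} (hf : ContinuousOn f (Icc 0 1)) :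
    (∫ t in (0 : ℝ)..1, f t) ^ 2 ≤ ∫ t in (0 : ℝ)..1, f t ^ 2 := by
  set m := ∫ t in (0 : ℝ)..1, f t with hm
  have hint : ∀ {g : ℝ → ℝ}, ContinuousOn g (Icc 0 1) → IntervalIntegrable g volume 0 1 :=
    fun hg => hg.intervalIntegrable_of_Icc zero_le_one
  have h : ∫ t in (0 : ℝ)..1, (2 * m * f t - m ^ 2) ≤ ∫ t in (0 : ℝ)..1, f t ^ 2 :=
    intervalIntegral.integral_mono_on zero_le_one
      (hint ((continuousOn_const.mul hf).sub continuousOn_const)) (hint (hf.pow 2))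
      fun t _ => by nlinarith [sq_nonneg (f t - m)]
  rw [intervalIntegral.integral_sub (f := fun t => 2 * m * f t) (g := fun _ => m ^ 2)
    (hint (continuousOn_const.mul hf)) intervalIntegrable_const,
    intervalIntegral.integral_const_mul, ← hm, intervalIntegral.integral_const] at h
  simp only [sub_zero, smul_eq_mul, one_mul] at h
  linarith

/-- Two points of `ℝ × S` are joined by a minimal geodesic inside the `2`-plane through their
spherical parts, given an orthonormal basis `p.2, ψ` of that plane. -/
theorem exists_isMinimalGeodesic {a : ℝ → ℝ} (ha : ContDiff ℝ ∞ a) (hpos : ∀ s, 0 < a s)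
    (p q : ℝ × Metric.sphere (0 : X) 1) {ψ : X} (hψ : ‖ψ‖ = 1)
    (hort : inner ℝ (p.2 : X) ψ = 0) {θ : ℝ} (hθ0 : 0 ≤ θ) (hθπ : θ ≤ Real.pi)
    (hq : (q.2 : X) = Real.cos θ • (p.2 : X) + Real.sin θ • ψ) :
    ∃ c : ℝ → ℝ × X, IsMinimalGeodesic a p q c ∧
      ∀ t, (c t).2 ∈ Submodule.span ℝ {(p.2 : X), ψ} := by
  obtain ⟨S, S', κ, hSd, hS'c, hS0, hS1, hS'd, hκ, hmin⟩ :=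
    exists_optimal_profile ha hpos p.1 q.1 hθ0
  have hu : UniqueDiffOn ℝ (Icc (0 : ℝ) 1) := uniqueDiffOn_Icc zero_lt_one
  have hda : ContDiff ℝ ∞ (deriv a) := (contDiff_infty_iff_deriv.1 ha).2
  have hκa : ContDiff ℝ ∞ fun x => κ / a x := contDiff_const.div ha fun x => (hpos x).ne'
  have hSsm : ContDiffOn ℝ ∞ S (Icc 0 1) :=
    contDiffOn_of_second_order (S' := S') (F := fun x => (1 / 2) * deriv a x * (κ / a x) ^ 2)
      ((contDiff_const.mul hda).mul (hκa.pow 2))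
      (fun t _ => (hSd t).hasDerivWithinAt) fun t ht => (hS'd t ht).hasDerivWithinAt
  have hSc : Continuous S := continuous_iff_continuousAt.2 fun t => (hSd t).continuousAt
  set w : ℝ → ℝ := fun t => κ / a (S t) with hw
  have hwc : Continuous w := hκa.continuous.comp hSc
  -- The angular momentum `a(S) w = κ` is constant; differentiating this gives the spherical
  -- geodesic equation.
  have hwd : ∀ t, HasDerivAt w (-(deriv a (S t) * S' t / a (S t)) * w t) t := fun t => by
    have h := ((((ha.differentiable (by simp)) (S t)).hasDerivAt.comp t (hSd t)).inv
      (hpos _).ne').const_mul κ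
    refine (h.congr_deriv ?_)
    have := (hpos (S t)).ne'
    simp only [hw, Function.comp_apply]
    field_simp
  set Θ : ℝ → ℝ := fun t => ∫ x in (0 : ℝ)..t, w x with hΘ
  have hΘd : ∀ t, HasDerivAt Θ (w t) t := fun t =>
    intervalIntegral.integral_hasDerivAt_right (hwc.intervalIntegrable _ _)
      (hwc.stronglyMeasurableAtFilter _ _) hwc.continuousAt
  have hΘsm : ContDiffOn ℝ ∞ Θ (Icc 0 1) := by
    rw [contDiffOn_infty_iff_derivWithin hu]
    refine ⟨fun t _ => (hΘd t).differentiableAt.differentiableWithinAt, ?_⟩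
    exact (hκa.comp_contDiffOn hSsm).congr fun t ht =>
      (hΘd t).hasDerivWithinAt.derivWithin (hu t ht)
  have hp1 : ‖(p.2 : X)‖ = 1 := norm_eq_of_mem_sphere p.2
  set φ : ℝ → X := fun t => Real.cos (Θ t) • (p.2 : X) + Real.sin (Θ t) • ψ with hφ
  set e : ℝ → X := fun t => -Real.sin (Θ t) • (p.2 : X) + Real.cos (Θ t) • ψ with he
  have hφd : ∀ t, HasDerivAt φ (w t • e t) t := fun t => by
    refine (((hΘd t).cos.smul_const (p.2 : X)).add ((hΘd t).sin.smul_const ψ)).congr_deriv ?_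
    simp only [he, smul_add, smul_smul]
    congr 2 <;> ring
  have hed : ∀ t, HasDerivAt e (-w t • φ t) t := fun t => by
    refine (((hΘd t).sin.neg.smul_const (p.2 : X)).add ((hΘd t).cos.smul_const ψ)).congr_deriv ?_
    simp only [hφ, smul_add, smul_smul]
    congr 2 <;> ring
  have hnorm : ∀ x y : ℝ, ‖x • (p.2 : X) + y • ψ‖ ^ 2 = x ^ 2 + y ^ 2 := fun x y => by
    rw [norm_add_sq_real, norm_smul, norm_smul, real_inner_smul_left, real_inner_smul_right, hort,
      hp1, hψ]
    simp [sq_abs]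
  have hφn : ∀ t, ‖φ t‖ = 1 := fun t => by
    have := hnorm (Real.cos (Θ t)) (Real.sin (Θ t))
    rw [Real.cos_sq_add_sin_sq] at this
    exact (pow_eq_one_iff_of_nonneg (norm_nonneg _) two_ne_zero).1 this
  have hen : ∀ t, ‖e t‖ = 1 := fun t => by
    have := hnorm (-Real.sin (Θ t)) (Real.cos (Θ t))
    rw [neg_sq, Real.sin_sq_add_cos_sq] at this
    exact (pow_eq_one_iff_of_nonneg (norm_nonneg _) two_ne_zero).1 this
  have hφe : ∀ t, inner ℝ (φ t) (e t) = 0 := fun t => by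
    simp only [hφ, he, inner_add_left, inner_add_right, real_inner_smul_left,
      real_inner_smul_right, hort, real_inner_comm (p.2 : X) ψ, real_inner_self_eq_norm_sq, hp1, hψ]
    ring
  set c : ℝ → ℝ × X := fun t => (S t, φ t) with hc
  have hv : ∀ t ∈ Icc (0 : ℝ) 1, velocity c t = (S' t, w t • e t) := fun t ht =>
    ((hSd t).prodMk (hφd t)).hasDerivWithinAt.derivWithin (hu t ht)
  have hacc : ∀ t ∈ Icc (0 : ℝ) 1, acceleration c t =
      ((1 / 2) * deriv a (S t) * w t ^ 2,
        (-(deriv a (S t) * S' t / a (S t)) * w t) • e t - w t ^ 2 • φ t) := fun t ht => by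
    have h : HasDerivAt (fun t => (S' t, w t • e t)) ((1 / 2) * deriv a (S t) * w t ^ 2,
        (-(deriv a (S t) * S' t / a (S t)) * w t) • e t - w t ^ 2 • φ t) t := by
      refine (hS'd t ht).prodMk (((hwd t).smul (hed t)).congr_deriv ?_)
      rw [smul_smul, add_comm, sub_eq_add_neg, ← neg_smul]
      congr 2
      ring
    rw [acceleration, derivWithin_congr hv (hv t ht)]
    exact h.hasDerivWithinAt.derivWithin (hu t ht)
  have hcurve : IsCurve ⊤ p q c :=
    { contDiffOn := hSsm.prodMk
        (((Real.contDiff_cos.comp_contDiffOn hΘsm).smul contDiffOn_const).add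
          ((Real.contDiff_sin.comp_contDiffOn hΘsm).smul contDiffOn_const))
      mem_sphere := fun t _ => by simpa using hφn t
      source := by
        have : Θ 0 = 0 := intervalIntegral.integral_same
        simp [hc, hφ, hS0, this]
      target := by
        have : Θ 1 = θ := hκ
        simp [hc, hφ, hS1, this, hq] }
  refine ⟨c, ⟨hcurve, ⟨fun t ht => ?_, fun t ht => ?_⟩, fun d hd => ?_⟩, fun t => ?_⟩
  · rw [hv t ht, hacc t ht]
    simp only [hc, inner_sub_right, real_inner_smul_right, hφe, real_inner_self_eq_norm_sq, hφn,
      smul_smul]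
    simp
  · rw [hv t ht, hacc t ht]
    simp [norm_smul, hen, hc]
  · have hspeed : ∀ t ∈ Icc (0 : ℝ) 1,
        √((velocity c t).1 ^ 2 + a (c t).1 * ‖(velocity c t).2‖ ^ 2) ^ 2 =
          S' t ^ 2 + a (S t) * w t ^ 2 := fun t ht => by
      rw [Real.sq_sqrt (by have := (hpos (c t).1).le; positivity), hv t ht]
      simp [norm_smul, hen, hc]
    -- Constant speed of `c` is not needed: length squared is at most energy for `c`, while the
    -- reparametrized competitor has energy at most `(length + ε)²`.
    have hlen : curveLength a c ^ 2 ≤ ∫ t in (0 : ℝ)..1, (S' t ^ 2 + a (S t) * w t ^ 2) := by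
      refine (sq_integral_le_integral_sq (continuousOn_speed ha.continuous le_top
        hcurve.contDiffOn)).trans_eq ?_
      refine intervalIntegral.integral_congr fun t ht => ?_
      rw [uIcc_of_le zero_le_one] at ht
      exact hspeed t ht
    refine le_of_forall_pos_le_add fun ε hε => ?_
    obtain ⟨D, D', hDc, hDd, hD'c, hD0, hD1, hDn, hDe⟩ :=
      exists_reparametrization ha.continuous hpos hd hε
    rw [hd.source] at hD0
    rw [hd.target] at hD1
    have hang : θ ≤ ∫ t in (0 : ℝ)..1, ‖(D' t).2‖ := by
      refine le_of_eq_of_le ?_ (arccos_inner_le_integral_norm (φ := fun t => (D t).2)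
        hDc.snd (fun t ht => ?_) hD'c.snd hDn)
      · simp only [hD0, hD1, hq, inner_add_right, real_inner_smul_right, hort,
          real_inner_self_eq_norm_sq, hp1]
        simp [Real.arccos_cos hθ0 hθπ]
      · exact (hasDerivWithinAt_snd (hDd t ht).hasDerivWithinAt (S := univ)).hasDerivAt univ_mem
    have hle := hmin (fun t => (D t).1) (fun t => (D' t).1) (fun t => ‖(D' t).2‖) hDc.fst
      (fun t ht =>
        (hasDerivWithinAt_fst (hDd t ht).hasDerivWithinAt (S := univ)).hasDerivAt univ_mem)
      hD'c.fst hD'c.snd.norm (by simp [hD0]) (by simp [hD1]) hang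
    have hub : ∫ t in (0 : ℝ)..1, ((D' t).1 ^ 2 + a (D t).1 * ‖(D' t).2‖ ^ 2) ≤
        (curveLength a d + ε) ^ 2 := by
      have := intervalIntegral.integral_mono_on (f := fun t => (D' t).1 ^ 2 +
        a (D t).1 * ‖(D' t).2‖ ^ 2) (g := fun _ => (curveLength a d + ε) ^ 2) (μ := volume)
        zero_le_one (((hD'c.fst.pow 2).add ((ha.continuous.comp_continuousOn hDc.fst).mul
          (hD'c.snd.norm.pow 2))).intervalIntegrable_of_Icc zero_le_one)
        intervalIntegrable_const hDe
      simpa using this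
    have hnonneg : 0 ≤ curveLength a d :=
      intervalIntegral.integral_nonneg zero_le_one fun t _ => Real.sqrt_nonneg _
    exact le_of_sq_le_sq (hlen.trans (hle.trans hub)) (by positivity)
  · exact Submodule.mem_span_pair.2 ⟨_, _, rfl⟩

end Existence

/-! ### Choice of the plane of the great circle. -/

section Plane

variable {X : Type*} [NormedAddCommGroup X] [InnerProductSpace ℝ X]

/-- Two unit vectors in a subspace that is not a line lie in a plane of the subspace, in which they
enclose an angle in `[0, π]`. -/
theorem exists_orthonormal_angle {V : Submodule ℝ X} {x y : X} (hx : x ∈ V) (hy : y ∈ V)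
    (hx1 : ‖x‖ = 1) (hy1 : ‖y‖ = 1) (hV : ∃ z ∈ V, z ∉ Submodule.span ℝ {x}) :
    ∃ ψ ∈ V, ‖ψ‖ = 1 ∧ inner ℝ x ψ = 0 ∧ ∃ θ, 0 ≤ θ ∧ θ ≤ Real.pi ∧
      y = Real.cos θ • x + Real.sin θ • ψ := by
  have hort : ∀ z, inner ℝ x (z - inner ℝ x z • x) = 0 := fun z => by
    rw [inner_sub_right, real_inner_smul_right, real_inner_self_eq_norm_sq, hx1]
    ring
  set r := y - inner ℝ x y • x with hr
  have hrn : ‖r‖ ^ 2 = 1 - inner ℝ x y ^ 2 := by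
    rw [hr, norm_sub_sq_real, real_inner_smul_right, norm_smul, hx1, hy1, Real.norm_eq_abs,
      mul_one, sq_abs, real_inner_comm]
    ring
  -- If `y = ±x`, the end points determine no plane and any direction of `V` off the line of `x`
  -- serves, with angle `0` or `π`.
  obtain ⟨w, hwV, hw0, hwx, hrw⟩ : ∃ w ∈ V, w ≠ 0 ∧ inner ℝ x w = 0 ∧ (r = 0 ∨ r = w) := by
    by_cases h : r = 0
    · obtain ⟨z, hzV, hz⟩ := hV
      refine ⟨z - inner ℝ x z • x, V.sub_mem hzV (V.smul_mem _ hx), fun h0 => hz ?_, hort z,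
        Or.inl h⟩
      exact Submodule.mem_span_singleton.2 ⟨_, (sub_eq_zero.1 h0).symm⟩
    · exact ⟨r, V.sub_mem hy (V.smul_mem _ hx), h, hort y, Or.inr rfl⟩
  have hwn : ‖w‖ ≠ 0 := norm_ne_zero_iff.2 hw0
  have hin := abs_le.1 (abs_real_inner_le_norm x y)
  rw [hx1, hy1, one_mul] at hin
  refine ⟨‖w‖⁻¹ • w, V.smul_mem _ hwV, ?_, ?_, Real.arccos (inner ℝ x y), Real.arccos_nonneg _,
    Real.arccos_le_pi _, ?_⟩
  · rw [norm_smul, norm_inv, norm_norm, inv_mul_cancel₀ hwn]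
  · rw [real_inner_smul_right, hwx, mul_zero]
  · rw [Real.cos_arccos hin.1 hin.2, Real.sin_arccos, ← hrn, Real.sqrt_sq (norm_nonneg _),
      smul_smul]
    have h : (‖r‖ * ‖w‖⁻¹) • w = r := by
      rcases hrw with h | h
      · rw [h, norm_zero, zero_mul, zero_smul]
      · rw [h, mul_inv_cancel₀ hwn, one_smul]
    rw [h, hr, add_sub_cancel]

theorem exists_notMem_span_singleton {V : Submodule ℝ X} {u v : X} (hu : u ∈ V) (hv : v ∈ V)
    (h : ∀ α β : ℝ, α • u + β • v = 0 → α = 0 ∧ β = 0) (x : X) :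
    ∃ z ∈ V, z ∉ Submodule.span ℝ {x} := by
  by_contra! hall
  obtain ⟨α, hα⟩ := Submodule.mem_span_singleton.1 (hall u hu)
  obtain ⟨β, hβ⟩ := Submodule.mem_span_singleton.1 (hall v hv)
  have h1 : β • u + (-α) • v = 0 := by
    rw [← hα, ← hβ, smul_smul, smul_smul, ← add_smul]
    ring_nf
    exact zero_smul _ _
  have hβ0 := (h _ _ h1).1
  rw [hβ0, zero_smul] at hβ
  have := (h 0 1 (by simp [← hβ])).2
  exact one_ne_zero this

end Plane

/-! ### Smooth classes in `L²`. -/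

section SmoothClass

variable {m : ℕ} {H : Type*} [TopologicalSpace H]
  (I : ModelWithCorners ℝ (EuclideanSpace ℝ (Fin m)) H)
  {M : Type*} [TopologicalSpace M] [ChartedSpace H M] [MeasurableSpace M]

/-- A smooth positive density charges every nonempty open set. -/
theorem IsSmoothPositiveDensity.isOpenPosMeasure [BorelSpace M] {μ : Measure M}
    (hμ : IsSmoothPositiveDensity I μ) : μ.IsOpenPosMeasure := by
  refine ⟨fun U hU ⟨x, hx⟩ h0 => ?_⟩
  obtain ⟨ρ, hρ, hρpos, hρμ⟩ := hμ (chartAt H x) (chart_mem_atlas H x)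
  set e := chartAt H x with he
  have hxe : x ∈ e.source := mem_chart_source H x
  set A := U ∩ e.source with hA
  have hAo : IsOpen A := hU.inter e.open_source
  have hμA : ∫⁻ y in e.extend I '' A, ENNReal.ofReal (ρ y) = 0 := by
    rw [← hρμ A hAo.measurableSet inter_subset_right]
    exact measure_mono_null inter_subset_left h0
  have hnhds : e.extend I '' A ∈ 𝓝[range I] e.extend I x := by
    rw [← e.map_extend_nhds hxe]
    exact image_mem_map (hAo.mem_nhds ⟨hx, hxe⟩)
  obtain ⟨O, hO, hxO, hOA⟩ := mem_nhdsWithin.1 hnhds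
  -- The point may lie on the boundary or a corner; the range of the model is in the closure of its
  -- interior, so the image of `A` still contains a nonempty open set `W`, which has positive
  -- Lebesgue measure.
  have hcl : e.extend I x ∈ closure (interior (range I)) :=
    I.range_subset_closure_interior (mem_range_self _)
  have hWne : (O ∩ interior (range I)).Nonempty := mem_closure_iff.1 hcl O hO hxO
  set W := O ∩ interior (range I) with hW
  have hWo : IsOpen W := hO.inter isOpen_interior
  have hWA : W ⊆ e.extend I '' A := (inter_subset_inter_right _ interior_subset).trans hOA
  have hWt : W ⊆ (e.extend I).target := by
    refine hWA.trans ?_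
    rintro _ ⟨z, hz, rfl⟩
    exact (e.extend I).map_source (by rw [e.extend_source]; exact hz.2)
  have hW0 : ∫⁻ y in W, ENNReal.ofReal (ρ y) = 0 :=
    le_antisymm ((lintegral_mono_set hWA).trans hμA.le) zero_le
  have hmeas : AEMeasurable (fun y => ENNReal.ofReal (ρ y)) (volume.restrict W) :=
    ((hρ.continuousOn.mono hWt).aemeasurable hWo.measurableSet).ennreal_ofReal
  rw [lintegral_eq_zero_iff' hmeas] at hW0
  have hfalse : ∀ᵐ _ ∂(volume.restrict W), False := by
    filter_upwards [hW0, ae_restrict_mem hWo.measurableSet] with y hy hyW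
    exact (ENNReal.ofReal_pos.2 (hρpos y (hWt hyW))).ne' hy
  have h1 : volume.restrict W = 0 := by
    rwa [eventually_false_iff_eq_bot, ae_eq_bot] at hfalse
  exact (hWo.measure_pos volume hWne).ne' (Measure.restrict_eq_zero.1 h1)

/-- The linear subspace of classes in `L²` that are represented by smooth functions. -/
def smoothClasses (μ : Measure M) : Submodule ℝ (Lp ℝ 2 μ) where
  carrier := {φ | IsSmoothClass I φ}
  add_mem' := by
    rintro φ χ ⟨f, hf, hφ⟩ ⟨g, hg, hχ⟩
    exact ⟨f + g, hf.add hg, (Lp.coeFn_add φ χ).trans (hφ.add hχ)⟩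
  zero_mem' := ⟨0, contMDiff_const, Lp.coeFn_zero _ _ _⟩
  smul_mem' := by
    rintro r φ ⟨f, hf, hφ⟩
    exact ⟨r • f, ((contDiff_const (c := r)).mul contDiff_id).contMDiff.comp hf, (Lp.coeFn_smul r φ).trans (hφ.const_smul r)⟩

/-- On a compact manifold with more than one point there are two linearly independent smooth
classes. -/
theorem exists_independent_smoothClasses [IsManifold I ∞ M] [T2Space M] [CompactSpace M]
    [Nontrivial M] [BorelSpace M] (μ : Measure M) [IsFiniteMeasure μ]
    (hμ : IsSmoothPositiveDensity I μ) :
    ∃ u ∈ smoothClasses I μ, ∃ v ∈ smoothClasses I μ,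
      ∀ α β : ℝ, α • u + β • v = 0 → α = 0 ∧ β = 0 := by
  have := hμ.isOpenPosMeasure I
  obtain ⟨x, y, hxy⟩ := exists_pair_ne M
  -- A smooth function separating two points and the constant `1` are independent: a combination
  -- vanishing almost everywhere vanishes everywhere by continuity, and the values at `x` and `y`
  -- give both coefficients.
  obtain ⟨f, hf0, hf1, -⟩ := exists_contMDiffMap_zero_one_of_isClosed (n := ⊤) I
    (isClosed_singleton (x := x)) (isClosed_singleton (x := y)) (by simpa using hxy)
  have hfc : Continuous f := f.contMDiff.continuous
  obtain ⟨B, hB⟩ := isCompact_univ.exists_bound_of_continuousOn hfc.continuousOn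
  have hfL : MemLp f 2 μ := MemLp.of_bound hfc.aestronglyMeasurable B
    (Eventually.of_forall fun z => hB z (mem_univ z))
  have h1L : MemLp (fun _ : M => (1 : ℝ)) 2 μ := memLp_const 1
  refine ⟨hfL.toLp, ⟨f, f.contMDiff, hfL.coeFn_toLp⟩, h1L.toLp,
    ⟨fun _ => 1, contMDiff_const, h1L.coeFn_toLp⟩, fun α β h => ?_⟩
  have hae : (fun z => α * f z + β) =ᵐ[μ] fun _ => 0 := by
    have h0 := Lp.coeFn_zero ℝ 2 μ
    rw [← h] at h0
    filter_upwards [h0, Lp.coeFn_add (α • hfL.toLp) (β • h1L.toLp), Lp.coeFn_smul α hfL.toLp,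
      Lp.coeFn_smul β h1L.toLp, hfL.coeFn_toLp, h1L.coeFn_toLp] with z e0 e1 e2 e3 e4 e5
    rw [e1, Pi.add_apply, e2, e3, Pi.smul_apply, Pi.smul_apply, e4, e5] at e0
    simpa using e0
  have heq := (Continuous.ae_eq_iff_eq μ (by fun_prop) continuous_const).1 hae
  have hx := congrFun heq x
  have hy := congrFun heq y
  simp only [hf0 (mem_singleton x), hf1 (mem_singleton y), Pi.zero_apply, Pi.one_apply] at hx hy
  constructor <;> linarith

end SmoothClass

end DensityMetric

/-! ### The theorem. -/

theorem mainTheorem3 {m : ℕ} {H : Type*} [TopologicalSpace H]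
    (I : ModelWithCorners ℝ (EuclideanSpace ℝ (Fin m)) H)
    {M : Type*} [TopologicalSpace M] [ChartedSpace H M] [IsManifold I ∞ M]
    [T2Space M] [CompactSpace M] [Nontrivial M] [MeasurableSpace M] [BorelSpace M]
    (μ₀ : Measure M) [IsProbabilityMeasure μ₀]
    (hμ₀ : DensityMetric.IsSmoothPositiveDensity I μ₀)
    (C₁ C₂ : ℝ → ℝ)
    (hC₁ : ContDiffOn ℝ ∞ C₁ (Ioi 0)) (hC₂ : ContDiffOn ℝ ∞ C₂ (Ioi 0))
    (hpos₁ : ∀ x : ℝ, 0 < x → 0 < C₁ x)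
    (hpos₂ : ∀ x : ℝ, 0 < x → -(1 / x) * C₁ x < C₂ x)
    (hW_minus : Tendsto (DensityMetric.radialW C₁ C₂) (𝓝[>] 0) atBot)
    (hW_plus : Tendsto (DensityMetric.radialW C₁ C₂) atTop atTop)
    (p q : ℝ × Metric.sphere (0 : Lp ℝ 2 μ₀) 1) :
    (∃ c : ℝ → ℝ × Lp ℝ 2 μ₀,
      DensityMetric.IsMinimalGeodesic (DensityMetric.warp C₁ C₂) p q c) ∧
    (DensityMetric.IsSmoothClass I (p.2 : Lp ℝ 2 μ₀) →
      DensityMetric.IsSmoothClass I (q.2 : Lp ℝ 2 μ₀) →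
      (∃ c : ℝ → ℝ × Lp ℝ 2 μ₀,
        DensityMetric.IsMinimalGeodesic (DensityMetric.warp C₁ C₂) p q c ∧
        ∀ t ∈ Icc (0 : ℝ) 1, DensityMetric.IsSmoothClass I (c t).2) ∧
      (q.2 ≠ -p.2 → ∀ c : ℝ → ℝ × Lp ℝ 2 μ₀,
        DensityMetric.IsMinimalGeodesic (DensityMetric.warp C₁ C₂) p q c →
        ∀ t ∈ Icc (0 : ℝ) 1, DensityMetric.IsSmoothClass I (c t).2)) := by
  have hs := DensityMetric.surjOn_radialW hC₁ hC₂ hpos₂ hW_minus hW_plus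
  have ha := DensityMetric.contDiff_warp hC₁ hC₂ hpos₂ hs
  have hpos := DensityMetric.warp_pos (C₂ := C₂) hpos₁ hs
  obtain ⟨u, hu, v, hv, huv⟩ := DensityMetric.exists_independent_smoothClasses I μ₀ hμ₀
  -- Used with `V = ⊤` and with `V` the smooth classes; `u` and `v` guarantee that `V` is not a
  -- line, which matters when the spherical parts are equal or antipodal.
  have key : ∀ V : Submodule ℝ (Lp ℝ 2 μ₀), u ∈ V → v ∈ V → (p.2 : Lp ℝ 2 μ₀) ∈ V →
      (q.2 : Lp ℝ 2 μ₀) ∈ V → ∃ c : ℝ → ℝ × Lp ℝ 2 μ₀,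
        DensityMetric.IsMinimalGeodesic (DensityMetric.warp C₁ C₂) p q c ∧ ∀ t, (c t).2 ∈ V := by
    intro V huV hvV hpV hqV
    obtain ⟨ψ, hψV, hψ1, hort, θ, hθ0, hθπ, hq⟩ := DensityMetric.exists_orthonormal_angle hpV hqV
      (norm_eq_of_mem_sphere p.2) (norm_eq_of_mem_sphere q.2)
      (DensityMetric.exists_notMem_span_singleton huV hvV huv _)
    obtain ⟨c, hc, hcV⟩ :=
      DensityMetric.exists_isMinimalGeodesic ha hpos p q hψ1 hort hθ0 hθπ hq
    refine ⟨c, hc, fun t => (Submodule.span_le.2 ?_) (hcV t)⟩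
    rintro _ (rfl | rfl)
    · exact hpV
    · exact hψV
  refine ⟨?_, fun hp hq => ⟨?_, fun hne c hc => ?_⟩⟩
  · obtain ⟨c, hc, -⟩ := key ⊤ trivial trivial trivial trivial
    exact ⟨c, hc⟩
  · obtain ⟨c, hc, hcV⟩ := key (DensityMetric.smoothClasses I μ₀) hu hv hp hq
    exact ⟨c, hc, fun t _ => hcV t⟩
  · by_cases h : q.2 = p.2
    · intro t ht
      rw [hc.snd_eq ha.continuous hpos h t ht]
      exact hp
    · exact hc.geodesic.mem_submodule ha hpos hc.isCurve (DensityMetric.smoothClasses I μ₀)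
        hp hq h hne
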